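/- Throughout, a 2-category is a weak 2-category (bicategory), a 2-functor is a weak 2-functor (pseudofunctor), and an isomorphism $\theta:\gamma\cong\gamma'$ between 2-functors that coincide on objects is a family of invertible 2-morphisms $\theta_g:\gamma(g)\cong\gamma'(g)$, one for each 1-morphism $g$, that is natural in $g$ and compatible with composition and with identities (there are no isomorphisms between 2-functors that differ on objects). An adjoint pair between objects $c,c'$ of a 2-category $\mathcal C$ is a quadruple $\langle f,f^\vee,a,a^\vee\rangle$ of 1-morphisms $f:c\to c'$, $f^\vee:c'\to c$ and 2-morphisms $a:f^\vee\circ f\to \mathrm{id}_c$, $a^\vee:\mathrm{id}_{c'}\to f\circ f^\vee$ such that $$(\mathrm{id}_f\circ a)\circ(a^\vee\circ \mathrm{id}_f)=\mathrm{id}_f,\qquad (a\circ \mathrm{id}_{f^\vee})\circ(\mathrm{id}_{f^\vee}\circ a^\vee)=\mathrm{id}_{f^\vee};$$ an isomorphism between two quadruples with the same $c,c'$ is a pair of invertible 2-morphisms between the $f$'s and between the $f^\vee$'s that is compatible with $a$ and $a^\vee$. Let $\Delta$ be the category of ordinals $[n]=\{0,\dots,n\}$, $n\ge 0$, and order-preserving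 maps, let $\Delta^<$ be $\Delta$ with an added initial object (the empty ordinal $\emptyset$), and let $\Delta_+,\Delta_-,\Delta_\pm\subset\Delta$ be the subcategories with the same objects and those maps that preserve the first element, the last element, resp. both. Let $\mathsf{adj}$ be the 2-category with two objects $0,1$ and with hom-categories $$\mathsf{adj}(1,1)=\Delta^<,\quad \mathsf{adj}(1,0)=\Delta_-,\quad \mathsf{adj}(0,1)=\Delta_+,\quad \mathsf{adj}(0,0)=\Delta_\pm ,$$ where the composition $\mathsf{adj}(i,j)\times\mathsf{adj}(j,k)\to\mathsf{adj}(i,k)$ is concatenation of ordinals (disjoint union ordered left to right) if $j=1$, and reduced concatenation $[n]*[m]=[n]\sqcup_{[0]}[m]$ (the last element of $[n]$ is glued to the first element of $[m]$) if $j=0$, with identity 1-morphisms $\mathrm{id}_1=\emptyset$, $\mathrm{id}_0=[0]$. Let $\mathsf f:0\to1$ and $\mathsf f^\vee:1\to0$ be the ordinals $[0]$ in $\Delta_+$ and $\Delta_-$. Then $\mathsf f^\vee\circ\mathsf f=[1]\in\Delta_\pm$ and $\mathsf f\circ\mathsf f^\vee=[0]\in\Delta^<$; let $\mathsf a:\mathsf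 f^\vee\circ\mathsf f\to\mathrm{id}_0$ be the unique map $[1]\to[0]$, and $\mathsf a^\vee:\mathrm{id}_1\to\mathsf f\circ\mathsf f^\vee$ the unique map $\emptyset\to[0]$. **Lemma.** The quadruple $\langle\mathsf f,\mathsf f^\vee,\mathsf a,\mathsf a^\vee\rangle$ is an adjoint pair in $\mathsf{adj}$. For any adjoint pair $\langle f,f^\vee,a,a^\vee\rangle$ between objects $c,c'$ of a 2-category $\mathcal C$ there exist a 2-functor $\gamma:\mathsf{adj}\to\mathcal C$ with $\gamma(0)=c$, $\gamma(1)=c'$ and an isomorphism of quadruples $\varphi:\gamma(\langle\mathsf f,\mathsf f^\vee,\mathsf a,\mathsf a^\vee\rangle)\cong\langle f,f^\vee,a,a^\vee\rangle$, and the pair $\langle\gamma,\varphi\rangle$ is unique up to a unique isomorphism: for any two such pairs $\langle\gamma,\varphi\rangle$, $\langle\gamma',\varphi'\rangle$ there is exactly one isomorphism of 2-functors $\theta:\gamma\cong\gamma'$ such that $\varphi'\circ\theta=\varphi$ on $\mathsf f$ and on $\mathsf f^\vee$. -/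

import Mathlib

open CategoryTheory Bicategory

universe w v u w₁ v₁ u₁

/-! ## The 2-category `adj` -/

/-- The two objects `0`, `1` of the 2-category `adj`. -/
inductive AdjObj : Type
  | zero : AdjObj
  | one : AdjObj

namespace AdjObj

/-- The number of elements that are identified when ordinals are composed at a given object:
composition at `1` is concatenation (nothing is identified), composition at `0` is reduced
concatenation (the last element of the first ordinal is identified with the first element of
the second one). -/
def overlap : AdjObj → ℕ
  | zero => 1
  | one => 0

/-- A 1-morphism `i ⟶ j` of `adj`: the finite ordinal `{0 < 1 < ⋯ < size - 1}`. It may be empty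
only if `i = j = 1`. -/
@[ext]
structure OneCell (i j : AdjObj) : Type where
  size : ℕ
  pos_left : i = zero → 0 < size
  pos_right : j = zero → 0 < size

/-- A 2-morphism of `adj`: an order-preserving map, which preserves the first element if the
source object is `0`, and preserves the last element if the target object is `0`. -/
@[ext]
structure TwoCell {i j : AdjObj} (u v : OneCell i j) : Type where
  toMap : Fin u.size →o Fin v.size
  map_first : i = zero → ∀ x : Fin u.size, x.val = 0 → (toMap x).val = 0
  map_last : j = zero → ∀ x : Fin u.size, x.val + 1 = u.size → (toMap x).val + 1 = v.size

theorem OneCell.overlap_left_le {i j : AdjObj} (u : OneCell i j) : i.overlap ≤ u.size := by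
  cases i with
  | zero => exact u.pos_left rfl
  | one => exact Nat.zero_le _

theorem OneCell.overlap_right_le {i j : AdjObj} (u : OneCell i j) : j.overlap ≤ u.size := by
  cases j with
  | zero => exact u.pos_right rfl
  | one => exact Nat.zero_le _

instance oneCellCategory (i j : AdjObj) : Category.{0} (OneCell i j) where
  Hom u v := TwoCell u v
  id u := ⟨OrderHom.id, fun _ _ h => h, fun _ _ h => h⟩
  comp η θ := ⟨θ.toMap.comp η.toMap,
    fun h x hx => θ.map_first h _ (η.map_first h x hx),
    fun h x hx => θ.map_last h _ (η.map_last h x hx)⟩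

theorem twoCell_ext {i j : AdjObj} {u v : OneCell i j} {η θ : u ⟶ v}
    (h : ∀ x, (η.toMap x).val = (θ.toMap x).val) : η = θ :=
  TwoCell.ext (OrderHom.ext _ _ (funext fun x => Fin.ext (h x)))

@[simp]
theorem id_toMap {i j : AdjObj} {u : OneCell i j} (x : Fin u.size) :
    TwoCell.toMap (𝟙 u) x = x := rfl

@[simp]
theorem comp_toMap {i j : AdjObj} {u v t : OneCell i j} (η : u ⟶ v) (θ : v ⟶ t)
    (x : Fin u.size) : (η ≫ θ).toMap x = θ.toMap (η.toMap x) := rfl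

/-- The identity 1-morphisms: the one-element ordinal for `0`, the empty ordinal for `1`. -/
def idCell (i : AdjObj) : OneCell i i where
  size := i.overlap
  pos_left h := by subst h; exact Nat.one_pos
  pos_right h := by subst h; exact Nat.one_pos

/-- Composition of 1-morphisms: concatenation at `1`, reduced concatenation at `0`. -/
def compCell {i j k : AdjObj} (u : OneCell i j) (v : OneCell j k) : OneCell i k where
  size := u.size + v.size - j.overlap
  pos_left h := by
    have h1 := u.pos_left h
    have h2 := v.overlap_left_le
    cases j with
    | zero => have := v.pos_left rfl; simp only [overlap]; omega
    | one => simp only [overlap]; omega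
  pos_right h := by
    have h1 := v.pos_right h
    have h2 := u.overlap_right_le
    cases j with
    | zero => have := u.pos_right rfl; simp only [overlap]; omega
    | one => simp only [overlap]; omega

@[simp]
theorem idCell_size (i : AdjObj) : (idCell i).size = i.overlap := rfl

@[simp]
theorem compCell_size {i j k : AdjObj} (u : OneCell i j) (v : OneCell j k) :
    (compCell u v).size = u.size + v.size - j.overlap := rfl

/-- The map underlying the horizontal composition: it acts by `η` on the first ordinal and by `θ`
on the second one. -/
def hcompFun {i j k : AdjObj} {u u' : OneCell i j} {v v' : OneCell j k}
    (η : u ⟶ u') (θ : v ⟶ v') (x : Fin (compCell u v).size) : Fin (compCell u' v').size :=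
  if h : x.val < u.size then
    ⟨(η.toMap ⟨x.val, h⟩).val, by
      have h1 := (η.toMap ⟨x.val, h⟩).isLt
      have h2 := v'.overlap_left_le
      simp only [compCell_size]; omega⟩
  else
    ⟨u'.size - j.overlap + (θ.toMap ⟨x.val - (u.size - j.overlap), by
        have h1 := x.isLt
        have h2 := u.overlap_right_le
        simp only [compCell_size] at h1; omega⟩).val, by
      have h1 := (θ.toMap ⟨x.val - (u.size - j.overlap), by
        have h1 := x.isLt
        have h2 := u.overlap_right_le
        simp only [compCell_size] at h1; omega⟩).isLt
      have h2 := u'.overlap_right_le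
      simp only [compCell_size]; omega⟩

theorem hcompFun_left {i j k : AdjObj} {u u' : OneCell i j} {v v' : OneCell j k}
    (η : u ⟶ u') (θ : v ⟶ v') (x : Fin (compCell u v).size) (y : Fin u.size)
    (h : x.val = y.val) : (hcompFun η θ x).val = (η.toMap y).val := by
  have hx : x.val < u.size := h ▸ y.isLt
  have e : (⟨x.val, hx⟩ : Fin u.size) = y := Fin.ext h
  rw [hcompFun, dif_pos hx]
  simp only [e]

theorem hcompFun_right {i j k : AdjObj} {u u' : OneCell i j} {v v' : OneCell j k}
    (η : u ⟶ u') (θ : v ⟶ v') (x : Fin (compCell u v).size) (y : Fin v.size)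
    (h : x.val = u.size - j.overlap + y.val) :
    (hcompFun η θ x).val = u'.size - j.overlap + (θ.toMap y).val := by
  by_cases hx : x.val < u.size
  · rw [hcompFun, dif_pos hx]
    cases j with
    | one => simp only [overlap] at h; omega
    | zero =>
      have h0 := u.pos_right rfl
      simp only [overlap] at h ⊢
      have hy : y.val = 0 := by omega
      have h1 := η.map_last rfl ⟨x.val, hx⟩ (by simp only; omega)
      have h2 := θ.map_first rfl y hy
      rw [h2]
      omega
  · rw [hcompFun, dif_neg hx]
    have e : ∀ p, (⟨x.val - (u.size - j.overlap), p⟩ : Fin v.size) = y :=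
      fun p => Fin.ext (by simp only; omega)
    simp only [e]

/-- Every element of a composite ordinal comes from the first or from the second ordinal. -/
theorem compCell_cases {i j k : AdjObj} (u : OneCell i j) (v : OneCell j k)
    (x : Fin (compCell u v).size) :
    (∃ y : Fin u.size, x.val = y.val) ∨
      ∃ y : Fin v.size, u.size ≤ x.val ∧ x.val = u.size - j.overlap + y.val := by
  have h1 := x.isLt
  have h2 := u.overlap_right_le
  simp only [compCell_size] at h1
  by_cases hx : x.val < u.size
  · exact Or.inl ⟨⟨x.val, hx⟩, rfl⟩
  · exact Or.inr ⟨⟨x.val - (u.size - j.overlap), by omega⟩, by omega, by simp only; omega⟩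

/-- Horizontal composition of 2-morphisms. -/
def hcomp {i j k : AdjObj} {u u' : OneCell i j} {v v' : OneCell j k}
    (η : u ⟶ u') (θ : v ⟶ v') : compCell u v ⟶ compCell u' v' where
  toMap :=
    { toFun := hcompFun η θ
      monotone' := by
        intro x y hxy
        have hxy' : x.val ≤ y.val := hxy
        show (hcompFun η θ x).val ≤ (hcompFun η θ y).val
        have hu := u'.overlap_right_le
        rcases compCell_cases u v x with ⟨a, ha⟩ | ⟨a, ha', ha⟩ <;>
          rcases compCell_cases u v y with ⟨b, hb⟩ | ⟨b, hb', hb⟩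
        · rw [hcompFun_left η θ x a ha, hcompFun_left η θ y b hb]
          have hab : a ≤ b := by show a.val ≤ b.val; omega
          exact η.toMap.monotone hab
        · rw [hcompFun_left η θ x a ha, hcompFun_right η θ y b hb]
          have h1 := (η.toMap a).isLt
          cases j with
          | zero => simp only [overlap]; omega
          | one => simp only [overlap]; omega
        · have := b.isLt
          omega
        · rw [hcompFun_right η θ x a ha, hcompFun_right η θ y b hb]
          have hab : a ≤ b := by show a.val ≤ b.val; omega
          have h1 : (θ.toMap a).val ≤ (θ.toMap b).val := θ.toMap.monotone hab
          omega }
  map_first h x hx := by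
    show (hcompFun η θ x).val = 0
    have h0 := u.pos_left h
    rw [hcompFun_left η θ x ⟨0, h0⟩ hx]
    exact η.map_first h _ rfl
  map_last h x hx := by
    show (hcompFun η θ x).val + 1 = _
    have h0 := v.pos_right h
    have h1 := u.overlap_right_le
    have h2 := u'.overlap_right_le
    have h3 := v'.pos_right h
    simp only [compCell_size] at hx ⊢
    have h4 := θ.map_last h ⟨v.size - 1, by omega⟩ (by simp only; omega)
    rw [hcompFun_right η θ x ⟨v.size - 1, by omega⟩ (by simp only; omega)]
    omega

theorem hcomp_left {i j k : AdjObj} {u u' : OneCell i j} {v v' : OneCell j k}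
    (η : u ⟶ u') (θ : v ⟶ v') (x : Fin (compCell u v).size) (y : Fin u.size)
    (h : x.val = y.val) : ((hcomp η θ).toMap x).val = (η.toMap y).val :=
  hcompFun_left η θ x y h

theorem hcomp_right {i j k : AdjObj} {u u' : OneCell i j} {v v' : OneCell j k}
    (η : u ⟶ u') (θ : v ⟶ v') (x : Fin (compCell u v).size) (y : Fin v.size)
    (h : x.val = u.size - j.overlap + y.val) :
    ((hcomp η θ).toMap x).val = u'.size - j.overlap + (θ.toMap y).val :=
  hcompFun_right η θ x y h

theorem hcomp_id {i j k : AdjObj} (u : OneCell i j) (v : OneCell j k) :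
    hcomp (𝟙 u) (𝟙 v) = 𝟙 (compCell u v) := by
  apply twoCell_ext
  intro x
  rcases compCell_cases u v x with ⟨a, ha⟩ | ⟨a, -, ha⟩
  · rw [hcomp_left _ _ x a ha]; exact ha.symm
  · rw [hcomp_right _ _ x a ha]; exact ha.symm

theorem hcomp_comp {i j k : AdjObj} {u u' u'' : OneCell i j} {v v' v'' : OneCell j k}
    (η : u ⟶ u') (η' : u' ⟶ u'') (θ : v ⟶ v') (θ' : v' ⟶ v'') :
    hcomp (η ≫ η') (θ ≫ θ') = hcomp η θ ≫ hcomp η' θ' := by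
  apply twoCell_ext
  intro x
  rw [comp_toMap]
  rcases compCell_cases u v x with ⟨a, ha⟩ | ⟨a, -, ha⟩
  · rw [hcomp_left _ _ x a ha, hcomp_left _ _ _ _ (hcomp_left η θ x a ha), comp_toMap]
  · rw [hcomp_right _ _ x a ha, hcomp_right _ _ _ _ (hcomp_right η θ x a ha), comp_toMap]

/-- The isomorphism between two 1-morphisms with the same underlying ordinal. -/
def castIso {i j : AdjObj} {u v : OneCell i j} (h : u.size = v.size) : u ≅ v where
  hom := ⟨⟨Fin.cast h, fun _ _ hxy => hxy⟩, fun _ _ hx => hx, fun _ _ hx => hx.trans h⟩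
  inv := ⟨⟨Fin.cast h.symm, fun _ _ hxy => hxy⟩, fun _ _ hx => hx,
    fun _ _ hx => hx.trans h.symm⟩
  hom_inv_id := twoCell_ext fun _ => rfl
  inv_hom_id := twoCell_ext fun _ => rfl

@[simp]
theorem castIso_hom_val {i j : AdjObj} {u v : OneCell i j} (h : u.size = v.size)
    (x : Fin u.size) : ((castIso h).hom.toMap x).val = x.val := rfl

@[simp]
theorem castIso_inv_val {i j : AdjObj} {u v : OneCell i j} (h : u.size = v.size)
    (x : Fin v.size) : ((castIso h).inv.toMap x).val = x.val := rfl

theorem toMap_congr {i j : AdjObj} {u v : OneCell i j} (η : u ⟶ v) {x y : Fin u.size}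
    (h : x.val = y.val) : (η.toMap x).val = (η.toMap y).val := by
  rw [Fin.ext h]

theorem assoc_size {i j k l : AdjObj} (u : OneCell i j) (v : OneCell j k) (t : OneCell k l) :
    (compCell (compCell u v) t).size = (compCell u (compCell v t)).size := by
  have h1 := u.overlap_right_le
  have h2 := v.overlap_left_le
  have h3 := v.overlap_right_le
  have h4 := t.overlap_left_le
  simp only [compCell_size]
  omega

theorem id_comp_size {i j : AdjObj} (u : OneCell i j) :
    (compCell (idCell i) u).size = u.size := by
  simp only [compCell_size, idCell_size]
  omega

theorem comp_id_size {i j : AdjObj} (u : OneCell i j) :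
    (compCell u (idCell j)).size = u.size := by
  simp only [compCell_size, idCell_size]
  omega

theorem hcomp_assoc {i j k l : AdjObj} {u u' : OneCell i j} {v v' : OneCell j k}
    {t t' : OneCell k l} (η : u ⟶ u') (θ : v ⟶ v') (ζ : t ⟶ t') :
    hcomp (hcomp η θ) ζ ≫ (castIso (assoc_size u' v' t')).hom =
      (castIso (assoc_size u v t)).hom ≫ hcomp η (hcomp θ ζ) := by
  apply twoCell_ext
  intro x
  simp only [comp_toMap, castIso_hom_val]
  have h1 := u.overlap_right_le
  have h2 := v.overlap_left_le
  have h3 := v.overlap_right_le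
  have h1' := u'.overlap_right_le
  have h2' := v'.overlap_left_le
  have h3' := v'.overlap_right_le
  have h4 := t.overlap_left_le
  rcases compCell_cases (compCell u v) t x with ⟨a, ha⟩ | ⟨a, -, ha⟩
  · rw [hcomp_left _ _ x a ha]
    rcases compCell_cases u v a with ⟨b, hb⟩ | ⟨b, -, hb⟩
    · rw [hcomp_left _ _ a b hb, hcomp_left _ _ _ b (by rw [castIso_hom_val]; omega)]
    · have hb' : b.val < (compCell v t).size := by
        have := b.isLt
        simp only [compCell_size]; omega
      rw [hcomp_right _ _ a b hb,
        hcomp_right _ _ _ ⟨b.val, hb'⟩ (by rw [castIso_hom_val]; simp only; omega),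
        hcomp_left _ _ _ b rfl]
  · have ha' : v.size - k.overlap + a.val < (compCell v t).size := by
      have := a.isLt
      simp only [compCell_size]; omega
    rw [hcomp_right _ _ x a ha,
      hcomp_right _ _ _ ⟨v.size - k.overlap + a.val, ha'⟩ (by
        rw [castIso_hom_val]; simp only [compCell_size] at ha ⊢; omega),
      hcomp_right _ _ _ a rfl]
    simp only [compCell_size]
    omega

theorem id_hcomp {i j : AdjObj} {u v : OneCell i j} (η : u ⟶ v) :
    hcomp (𝟙 (idCell i)) η ≫ (castIso (id_comp_size v)).hom =
      (castIso (id_comp_size u)).hom ≫ η := by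
  apply twoCell_ext
  intro x
  simp only [comp_toMap, castIso_hom_val]
  rw [hcomp_right _ _ x ((castIso (id_comp_size u)).hom.toMap x) (by
    simp only [castIso_hom_val, idCell_size]; omega)]
  simp only [idCell_size]
  omega

theorem hcomp_id_right {i j : AdjObj} {u v : OneCell i j} (η : u ⟶ v) :
    hcomp η (𝟙 (idCell j)) ≫ (castIso (comp_id_size v)).hom =
      (castIso (comp_id_size u)).hom ≫ η := by
  apply twoCell_ext
  intro x
  simp only [comp_toMap, castIso_hom_val]
  rw [hcomp_left _ _ x ((castIso (comp_id_size u)).hom.toMap x) rfl]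

theorem hcomp_castIso_right {i j k : AdjObj} (u : OneCell i j) {v v' : OneCell j k}
    (h : v.size = v'.size) :
    hcomp (𝟙 u) (castIso h).hom = (castIso (by simp only [compCell_size, h])).hom := by
  apply twoCell_ext
  intro x
  rcases compCell_cases u v x with ⟨a, ha⟩ | ⟨a, -, ha⟩
  · rw [hcomp_left _ _ x a ha]; exact ha.symm
  · rw [hcomp_right _ _ x a ha]; exact ha.symm

theorem hcomp_castIso_left {i j k : AdjObj} {u u' : OneCell i j} (v : OneCell j k)
    (h : u.size = u'.size) :
    hcomp (castIso h).hom (𝟙 v) = (castIso (by simp only [compCell_size, h])).hom := by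
  apply twoCell_ext
  intro x
  rcases compCell_cases u v x with ⟨a, ha⟩ | ⟨a, -, ha⟩
  · rw [hcomp_left _ _ x a ha]; exact ha.symm
  · rw [hcomp_right _ _ x a ha, id_toMap]
    exact (by omega : u'.size - j.overlap + a.val = x.val)

/-- The 2-category `adj`. The unitors and the associators are the identity maps on underlying
ordinals. -/
instance bicategory : Bicategory.{0, 0} AdjObj where
  Hom i j := OneCell i j
  id i := idCell i
  comp u v := compCell u v
  homCategory i j := oneCellCategory i j
  whiskerLeft u _ _ θ := hcomp (𝟙 u) θ
  whiskerRight η v := hcomp η (𝟙 v)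
  associator u v t := castIso (assoc_size u v t)
  leftUnitor u := castIso (id_comp_size u)
  rightUnitor u := castIso (comp_id_size u)
  whiskerLeft_id u v := hcomp_id u v
  whiskerLeft_comp u _ _ _ η θ := by rw [← hcomp_comp, Category.id_comp]
  id_whiskerLeft η := by rw [← Category.assoc, Iso.eq_comp_inv]; exact id_hcomp η
  comp_whiskerLeft u v _ _ η := by
    rw [← Category.assoc, Iso.eq_comp_inv, ← hcomp_assoc, hcomp_id]
  id_whiskerRight u v := hcomp_id u v
  comp_whiskerRight η θ v := by rw [← hcomp_comp, Category.id_comp]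
  whiskerRight_id η := by rw [← Category.assoc, Iso.eq_comp_inv]; exact hcomp_id_right η
  whiskerRight_comp η v t := by rw [Iso.eq_inv_comp, hcomp_assoc, hcomp_id]
  whisker_assoc u _ _ η t := by rw [← Category.assoc, Iso.eq_comp_inv, ← hcomp_assoc]
  whisker_exchange η θ := by
    rw [← hcomp_comp, ← hcomp_comp, Category.id_comp, Category.id_comp, Category.comp_id,
      Category.comp_id]
  pentagon u v t s := by
    rw [hcomp_castIso_left, hcomp_castIso_right]
    exact twoCell_ext fun _ => rfl
  triangle u v := by
    rw [hcomp_castIso_left, hcomp_castIso_right]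
    exact twoCell_ext fun _ => rfl

end AdjObj

/-! ## The categories `Δ^<`, `Δ_+`, `Δ_-`, `Δ_±`

`Δ` is `SimplexCategory`, and `Δ^<` is `AugmentedSimplexCategory`. -/

namespace SimplexMaps

/-- Maps `[m] ⟶ [n]` that preserve the first element. -/
def special : MorphismProperty SimplexCategory :=
  fun _ _ f => f.toOrderHom 0 = 0

/-- Maps `[m] ⟶ [n]` that preserve the last element. -/
def antispecial : MorphismProperty SimplexCategory :=
  fun _ _ f => f.toOrderHom (Fin.last _) = Fin.last _

/-- Maps that preserve both the first and the last element. -/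
def bispecial : MorphismProperty SimplexCategory :=
  fun _ _ f => special f ∧ antispecial f

instance : special.IsMultiplicative where
  id_mem _ := rfl
  comp_mem f g hf hg := by
    show g.toOrderHom (f.toOrderHom 0) = 0
    rw [show f.toOrderHom 0 = 0 from hf]
    exact hg

instance : antispecial.IsMultiplicative where
  id_mem _ := rfl
  comp_mem f g hf hg := by
    show g.toOrderHom (f.toOrderHom (Fin.last _)) = Fin.last _
    rw [show f.toOrderHom (Fin.last _) = Fin.last _ from hf]
    exact hg

instance : bispecial.IsMultiplicative where
  id_mem _ := ⟨rfl, rfl⟩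
  comp_mem f g hf hg :=
    ⟨special.comp_mem f g hf.1 hg.1, antispecial.comp_mem f g hf.2 hg.2⟩

end SimplexMaps

open SimplexMaps

/-- `Δ_+`. -/
abbrev DeltaPlus := WideSubcategory special

/-- `Δ_-`. -/
abbrev DeltaMinus := WideSubcategory antispecial

/-- `Δ_±`. -/
abbrev DeltaPM := WideSubcategory bispecial

namespace AdjObj

/-- The nonempty ordinal `[n]` as a 1-morphism of `adj`. -/
def ofSimplex (i j : AdjObj) (X : SimplexCategory) : OneCell i j :=
  ⟨X.len + 1, fun _ => Nat.succ_pos _, fun _ => Nat.succ_pos _⟩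

theorem special_first {X Y : SimplexCategory} {g : X ⟶ Y} (h : special g)
    (x : Fin (X.len + 1)) (hx : x.val = 0) : (g.toOrderHom x).val = 0 := by
  have e : x = (0 : Fin (X.len + 1)) := Fin.ext hx
  rw [e]
  exact congrArg Fin.val h

theorem antispecial_last {X Y : SimplexCategory} {g : X ⟶ Y} (h : antispecial g)
    (x : Fin (X.len + 1)) (hx : x.val + 1 = X.len + 1) :
    (g.toOrderHom x).val + 1 = Y.len + 1 := by
  have e : x = Fin.last X.len := Fin.ext (Nat.succ.inj hx)
  rw [e]
  exact congrArg (fun z => z.val + 1) h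

/-- The tautological functor from `Δ_+` to `adj(0,1)`. -/
def fromDeltaPlus : DeltaPlus ⥤ (zero ⟶ one) where
  obj X := ofSimplex zero one X.obj
  map {X Y} g := (show TwoCell (ofSimplex zero one X.obj) (ofSimplex zero one Y.obj) from
    { toMap := g.hom.toOrderHom
      map_first := fun _ => special_first g.property
      map_last := fun h => AdjObj.noConfusion h })
  map_id _ := rfl
  map_comp _ _ := rfl

/-- The tautological functor from `Δ_-` to `adj(1,0)`. -/
def fromDeltaMinus : DeltaMinus ⥤ (one ⟶ zero) where
  obj X := ofSimplex one zero X.obj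
  map {X Y} g := (show TwoCell (ofSimplex one zero X.obj) (ofSimplex one zero Y.obj) from
    { toMap := g.hom.toOrderHom
      map_first := fun h => AdjObj.noConfusion h
      map_last := fun _ => antispecial_last g.property })
  map_id _ := rfl
  map_comp _ _ := rfl

/-- The tautological functor from `Δ_±` to `adj(0,0)`. -/
def fromDeltaPM : DeltaPM ⥤ (zero ⟶ zero) where
  obj X := ofSimplex zero zero X.obj
  map {X Y} g := (show TwoCell (ofSimplex zero zero X.obj) (ofSimplex zero zero Y.obj) from
    { toMap := g.hom.toOrderHom
      map_first := fun _ => special_first g.property.1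
      map_last := fun _ => antispecial_last g.property.2 })
  map_id _ := rfl
  map_comp _ _ := rfl

/-- The tautological functor from `Δ` to `adj(1,1)`. -/
def fromDelta : SimplexCategory ⥤ (one ⟶ one) where
  obj X := ofSimplex one one X
  map {X Y} g := (show TwoCell (ofSimplex one one X) (ofSimplex one one Y) from
    { toMap := g.toOrderHom
      map_first := fun h => AdjObj.noConfusion h
      map_last := fun h => AdjObj.noConfusion h })
  map_id _ := rfl
  map_comp _ _ := rfl

/-- The unique 2-morphism from the empty ordinal. -/
def fromEmpty (u : OneCell one one) : idCell one ⟶ u where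
  toMap := ⟨fun x => x.elim0, fun x => x.elim0⟩
  map_first h := AdjObj.noConfusion h
  map_last h := AdjObj.noConfusion h

/-- The tautological functor from `Δ^<` to `adj(1,1)`; it sends the added initial object to the
empty ordinal. -/
def fromDeltaAug : AugmentedSimplexCategory ⥤ (one ⟶ one) :=
  WithInitial.lift fromDelta (Z := idCell one) (fun X => fromEmpty (fromDelta.obj X))
    (fun _ _ _ => twoCell_ext fun x => x.elim0)

end AdjObj

/-! ## Adjoint pairs -/

/-- The data `⟨f, f^∨, a, a^∨⟩` of an adjoint pair between objects `c` and `c'` of a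
2-category, without the relations; composition is written in diagrammatic order. -/
structure AdjQuadruple {C : Type u} [Bicategory.{w, v} C] (c c' : C) where
  f : c ⟶ c'
  fv : c' ⟶ c
  a : f ≫ fv ⟶ 𝟙 c
  av : 𝟙 c' ⟶ fv ≫ f

namespace AdjQuadruple

variable {C : Type u} [Bicategory.{w, v} C] {c c' : C}

/-- The quadruple is an adjoint pair: `f^∨` is left adjoint to `f` with unit `a^∨` and
counit `a`. -/
def IsAdjointPair (P : AdjQuadruple c c') : Prop :=
  ∃ h : Bicategory.Adjunction P.fv P.f, h.unit = P.av ∧ h.counit = P.a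

/-- An isomorphism of quadruples between the same two objects. -/
structure Iso (P Q : AdjQuadruple c c') where
  isoF : P.f ≅ Q.f
  isoFv : P.fv ≅ Q.fv
  a_comm : isoF.hom ▷ P.fv ≫ Q.f ◁ isoFv.hom ≫ Q.a = P.a
  av_comm : P.av ≫ isoFv.hom ▷ P.f ≫ Q.fv ◁ isoF.hom = Q.av

end AdjQuadruple

namespace AdjObj

/-- The generating 1-morphism `f : 0 ⟶ 1`, the ordinal `[0]`. -/
def genF : zero ⟶ one := (⟨1, fun _ => Nat.one_pos, fun _ => Nat.one_pos⟩ : OneCell _ _)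

/-- The generating 1-morphism `f^∨ : 1 ⟶ 0`, the ordinal `[0]`. -/
def genFv : one ⟶ zero := (⟨1, fun _ => Nat.one_pos, fun _ => Nat.one_pos⟩ : OneCell _ _)

/-- The universal quadruple. Here `f ≫ f^∨` is the ordinal `[1]` in `Δ_±`, and `a` is its unique
map to `[0]`; `f^∨ ≫ f` is the ordinal `[0]` in `Δ^<`, and `a^∨` is the unique map to it from the
empty ordinal. -/
def univ : AdjQuadruple zero one where
  f := genF
  fv := genFv
  a := (⟨⟨fun _ => ⟨0, Nat.one_pos⟩, fun _ _ _ => le_refl _⟩, fun _ _ _ => rfl,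
    fun _ _ _ => rfl⟩ : TwoCell (compCell genF genFv) (idCell zero))
  av := fromEmpty (compCell genFv genF)

end AdjObj

/-! ## 2-functors with a given effect on objects, and their isomorphisms -/

/-- The data of a pseudofunctor `B ⥤ᵖ C` other than its action `o` on objects. -/
structure PseudofunctorOn {B : Type u₁} [Bicategory.{w₁, v₁} B] {C : Type u}
    [Bicategory.{w, v} C] (o : B → C) where
  map {x y : B} : (x ⟶ y) → (o x ⟶ o y)
  map₂ {x y : B} {f g : x ⟶ y} : (f ⟶ g) → (map f ⟶ map g)
  map₂_id {x y : B} (f : x ⟶ y) : map₂ (𝟙 f) = 𝟙 (map f)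
  map₂_comp {x y : B} {f g h : x ⟶ y} (η : f ⟶ g) (θ : g ⟶ h) :
    map₂ (η ≫ θ) = map₂ η ≫ map₂ θ
  mapId (x : B) : map (𝟙 x) ≅ 𝟙 (o x)
  mapComp {x y z : B} (f : x ⟶ y) (g : y ⟶ z) : map (f ≫ g) ≅ map f ≫ map g
  map₂_whisker_left {x y z : B} (f : x ⟶ y) {g h : y ⟶ z} (η : g ⟶ h) :
    map₂ (f ◁ η) = (mapComp f g).hom ≫ map f ◁ map₂ η ≫ (mapComp f h).inv
  map₂_whisker_right {x y z : B} {f g : x ⟶ y} (η : f ⟶ g) (h : y ⟶ z) :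
    map₂ (η ▷ h) = (mapComp f h).hom ≫ map₂ η ▷ map h ≫ (mapComp g h).inv
  map₂_associator {x y z t : B} (f : x ⟶ y) (g : y ⟶ z) (h : z ⟶ t) :
    map₂ (α_ f g h).hom = (mapComp (f ≫ g) h).hom ≫ (mapComp f g).hom ▷ map h ≫
      (α_ (map f) (map g) (map h)).hom ≫ map f ◁ (mapComp g h).inv ≫
        (mapComp f (g ≫ h)).inv
  map₂_left_unitor {x y : B} (f : x ⟶ y) :
    map₂ (λ_ f).hom = (mapComp (𝟙 x) f).hom ≫ (mapId x).hom ▷ map f ≫ (λ_ (map f)).hom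
  map₂_right_unitor {x y : B} (f : x ⟶ y) :
    map₂ (ρ_ f).hom = (mapComp f (𝟙 y)).hom ≫ map f ◁ (mapId y).hom ≫ (ρ_ (map f)).hom

namespace PseudofunctorOn

variable {B : Type u₁} [Bicategory.{w₁, v₁} B] {C : Type u} [Bicategory.{w, v} C]

/-- The data of a given pseudofunctor. -/
def ofPseudofunctor (F : B ⥤ᵖ C) : PseudofunctorOn F.obj where
  map f := F.map f
  map₂ η := F.map₂ η
  map₂_id f := F.map₂_id f
  map₂_comp η θ := F.map₂_comp η θ
  mapId x := F.mapId x
  mapComp f g := F.mapComp f g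
  map₂_whisker_left f _ _ η := F.map₂_whisker_left f η
  map₂_whisker_right η h := F.map₂_whisker_right η h
  map₂_associator f g h := F.map₂_associator f g h
  map₂_left_unitor f := F.map₂_left_unitor f
  map₂_right_unitor f := F.map₂_right_unitor f

/-- The data of a pseudofunctor `F` whose action on objects is equal to `o`. -/
def of {o : B → C} (F : B ⥤ᵖ C) (h : F.obj = o) : PseudofunctorOn o :=
  h ▸ ofPseudofunctor F

/-- The pseudofunctor with given action on objects and given data. -/
def toPseudofunctor {o : B → C} (T : PseudofunctorOn o) : B ⥤ᵖ C where
  obj := o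
  map f := T.map f
  map₂ η := T.map₂ η
  map₂_id f := T.map₂_id f
  map₂_comp η θ := T.map₂_comp η θ
  mapId x := T.mapId x
  mapComp f g := T.mapComp f g
  map₂_whisker_left f _ _ η := T.map₂_whisker_left f η
  map₂_whisker_right η h := T.map₂_whisker_right η h
  map₂_associator f g h := T.map₂_associator f g h
  map₂_left_unitor f := T.map₂_left_unitor f
  map₂_right_unitor f := T.map₂_right_unitor f

theorem of_toPseudofunctor {o : B → C} (T : PseudofunctorOn o) : of T.toPseudofunctor rfl = T :=
  rfl

theorem toPseudofunctor_of {o : B → C} (F : B ⥤ᵖ C) (h : F.obj = o) :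
    (of F h).toPseudofunctor = F := by
  subst h
  rfl

/-- An isomorphism between 2-functors that coincide on objects: a family of invertible
2-morphisms `S f ≅ T f`, identical on objects, natural in `f`, and compatible with identities and
with composition. -/
@[ext]
structure Iso {o : B → C} (S T : PseudofunctorOn o) where
  app {x y : B} (f : x ⟶ y) : S.map f ≅ T.map f
  naturality {x y : B} {f g : x ⟶ y} (η : f ⟶ g) :
    S.map₂ η ≫ (app g).hom = (app f).hom ≫ T.map₂ η
  app_id (x : B) : (app (𝟙 x)).hom ≫ (T.mapId x).hom = (S.mapId x).hom
  app_comp {x y z : B} (f : x ⟶ y) (g : y ⟶ z) :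
    (app (f ≫ g)).hom ≫ (T.mapComp f g).hom =
      (S.mapComp f g).hom ≫ (app f).hom ▷ S.map g ≫ T.map f ◁ (app g).hom

/-- The image of a quadruple under a 2-functor. -/
def image {o : B → C} (T : PseudofunctorOn o) {x y : B} (P : AdjQuadruple x y) :
    AdjQuadruple (o x) (o y) where
  f := T.map P.f
  fv := T.map P.fv
  a := (T.mapComp P.f P.fv).inv ≫ T.map₂ P.a ≫ (T.mapId x).hom
  av := (T.mapId y).inv ≫ T.map₂ P.av ≫ (T.mapComp P.fv P.f).hom

end PseudofunctorOn

/-- The map from the objects of `adj` that sends `0` to `c` and `1` to `c'`. -/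
abbrev AdjObj.objMap {C : Type u} (c c' : C) : AdjObj → C
  | AdjObj.zero => c
  | AdjObj.one => c'

/-! Every 1-morphism of `adj` is an alternating word in the two generators, since a 1-morphism with
given ends is determined by its size. The content of the lemma is that 2-morphisms between words
have unique normal forms, built from the adjunction alone. If the source ends with `f^∨`, the map is
transposed across the adjunction (`lift`). If it ends with `f`, the last element either goes to the
last element of the target and can be stripped from consideration (`mapF`), or the last element of
the target is missed and the map factors through a unit (`skip`). From an identity word only the
identity and iterated units occur.

Normal forms can be evaluated in any `AdjModule`, that is, in any pair of categories with an
adjunction. Composition of normal forms follows rules valid in all modules, so their composition can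
be computed in `adj` itself: `NF.exists_comp` produces one normal form that represents the composite
in two modules at once, and one of the two is taken to be `adj(i, -)`. With `realNF_injective` and
`realNF_surjective` this makes `adj(i, -)` the free module on the generator `𝟙 i`: a morphism out of
it exists for each value at `𝟙 i` (`Hom.ofPoint`), and an isomorphism of these values extends to an
isomorphism of morphisms (`Hom.isoOfBase`).

An adjoint pair in `C` makes each family of hom-categories `x ⟶ o j` a module under postcomposition,
so freeness gives the pseudofunctor on 1- and 2-morphisms. The constraint for `t ≫ t'` compares two
morphisms of modules in the variable `t'` that agree at the identity. Its coherence is proved by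
induction on the last 1-morphism, one generator at a time. Freeness also compares any two solutions,
and an isomorphism of pseudofunctors is determined by its values on the generators. -/

namespace AdjObj

/-! ## Normal forms of the 1-morphisms and the 2-morphisms of `adj` -/

/-- The generating 1-morphisms of `adj`. -/
inductive Gen : AdjObj → AdjObj → Type
  | V : Gen one zero
  | F : Gen zero one

/-- Composable words in the generating 1-morphisms. -/
inductive Word (i : AdjObj) : AdjObj → Type
  | nil : Word i i
  | cons {j k : AdjObj} (t : Word i j) (e : Gen j k) : Word i k

/-- Normal forms of 2-morphisms between words: the inductive description of a monotone map
obtained by looking at the last element of its source. -/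
inductive NF {i : AdjObj} : {j : AdjObj} → Word i j → Word i j → Type
  | nil : NF Word.nil Word.nil
  | lift {s : Word i one} {t : Word i zero} (a : NF s (t.cons Gen.F)) : NF (s.cons Gen.V) t
  | mapF {s t : Word i zero} (a : NF s t) : NF (s.cons Gen.F) (t.cons Gen.F)
  | skip {s t : Word i one} (a : NF s t) : NF s ((t.cons Gen.V).cons Gen.F)

set_option linter.checkUnivs false in
/-- A pair of categories with an adjunction between them. -/
structure AdjModule where
  X : AdjObj → Type u
  [cat : ∀ j, Category.{v} (X j)]
  act : ∀ {j k : AdjObj}, Gen j k → X j ⥤ X k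
  adj : CategoryTheory.Adjunction (act Gen.V) (act Gen.F)

attribute [instance] AdjModule.cat

namespace AdjModule

variable (M : AdjModule.{v, u}) {i : AdjObj} (s : M.X i)

/-- The action of a word on a base point. -/
def ev : {j : AdjObj} → Word i j → M.X j
  | _, .nil => s
  | _, .cons t e => (M.act e).obj (ev t)

/-- The action of a normal form on a base point. -/
def evNF : {j : AdjObj} → {t t' : Word i j} → NF t t' → (M.ev s t ⟶ M.ev s t')
  | _, _, _, .nil => 𝟙 s
  | _, _, _, .lift a => (M.adj.homEquiv _ _).symm (evNF a)
  | _, _, _, .mapF a => (M.act Gen.F).map (evNF a)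
  | _, _, _, .skip a => evNF a ≫ M.adj.unit.app _

end AdjModule

/-! ### Identities and composites of normal forms, in two modules simultaneously -/

theorem NF.exists_id {i : AdjObj} (M : AdjModule.{v, u}) (s : M.X i) (N : AdjModule.{v₁, u₁})
    (r : N.X i) {j : AdjObj} (t : Word i j) :
    ∃ a : NF t t, M.evNF s a = 𝟙 _ ∧ N.evNF r a = 𝟙 _ := by
  induction t with
  | nil => exact ⟨.nil, rfl, rfl⟩
  | cons t e ih =>
    obtain ⟨a, ha, ha'⟩ := ih
    cases e with
    | V =>
      -- The transpose of the identity of `L x` is the unit at `x`, so the identity of a word ending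
      -- with `f^∨` is the transpose of a unit.
      refine ⟨.lift (.skip a), ?_, ?_⟩
      · refine (Equiv.symm_apply_eq _).2 (.trans ?_ (M.adj.homEquiv_id _).symm)
        simp only [AdjModule.evNF, ha]
        exact Category.id_comp _
      · refine (Equiv.symm_apply_eq _).2 (.trans ?_ (N.adj.homEquiv_id _).symm)
        simp only [AdjModule.evNF, ha']
        exact Category.id_comp _
    | F =>
      refine ⟨.mapF a, ?_, ?_⟩
      · simp [AdjModule.evNF, ha, AdjModule.ev]
      · simp [AdjModule.evNF, ha', AdjModule.ev]

theorem AdjModule.evNF_lift_comp {i : AdjObj} (M : AdjModule.{v, u}) (s : M.X i)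
    {t : Word i one} {t' t'' : Word i zero} {a : NF t (t'.cons Gen.F)} {b : NF t' t''}
    {c : NF t (t''.cons Gen.F)} (h : M.evNF s c = M.evNF s a ≫ M.evNF s (.mapF b)) :
    M.evNF s (.lift c) = M.evNF s (.lift a) ≫ M.evNF s b :=
  (congrArg _ h).trans (M.adj.homEquiv_naturality_right_symm _ _)

/-- The cancellation rule of the calculus: a unit followed by the image of a transpose is the
original morphism. This is where a triangle identity enters composition. -/
theorem AdjModule.evNF_skip_comp_mapF_lift {i : AdjObj} (M : AdjModule.{v, u}) (s : M.X i)
    {t t' : Word i one} {t'' : Word i zero} (a : NF t t') (b : NF t' (t''.cons Gen.F)) :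
    M.evNF s (.skip a) ≫ M.evNF s (.mapF (.lift b)) = M.evNF s a ≫ M.evNF s b := by
  have h := (M.adj.homEquiv_unit (f := (M.adj.homEquiv _ (M.ev s t'')).symm (M.evNF s b)))
  exact (Category.assoc _ _ _).trans
    (congrArg (M.evNF s a ≫ ·) (h.symm.trans (Equiv.apply_symm_apply _ _)))

/-- The choice of `c` depends on `a` and `b` only through their constructors, so the same normal
form works in both modules. The rules used are naturality of transposition, functoriality,
associativity and the cancellation rule. -/
theorem NF.exists_comp {i : AdjObj} (M : AdjModule.{v, u}) (s : M.X i) (N : AdjModule.{v₁, u₁})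
    (r : N.X i) : ∀ {j : AdjObj} {t t' t'' : Word i j} (a : NF t t') (b : NF t' t''),
    ∃ c : NF t t'', M.evNF s c = M.evNF s a ≫ M.evNF s b ∧
      N.evNF r c = N.evNF r a ≫ N.evNF r b
  | _, _, _, _, .nil, b => ⟨b, (Category.id_comp _).symm, (Category.id_comp _).symm⟩
  | _, _, _, _, .lift a, b => by
    obtain ⟨c, hc, hc'⟩ := NF.exists_comp M s N r a (.mapF b)
    exact ⟨.lift c, M.evNF_lift_comp s hc, N.evNF_lift_comp r hc'⟩
  | _, _, _, _, .mapF a, .mapF b => by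
    obtain ⟨c, hc, hc'⟩ := NF.exists_comp M s N r a b
    exact ⟨.mapF c, (congrArg _ hc).trans (Functor.map_comp _ _ _),
      (congrArg _ hc').trans (Functor.map_comp _ _ _)⟩
  | _, _, _, _, .mapF a, .skip b => by
    obtain ⟨c, hc, hc'⟩ := NF.exists_comp M s N r (.mapF a) b
    exact ⟨.skip c, (congrArg (· ≫ _) hc).trans (Category.assoc _ _ _),
      (congrArg (· ≫ _) hc').trans (Category.assoc _ _ _)⟩
  | _, _, _, _, .skip a, .mapF (.lift b) => by
    obtain ⟨c, hc, hc'⟩ := NF.exists_comp M s N r a b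
    exact ⟨c, hc.trans (M.evNF_skip_comp_mapF_lift s a b).symm,
      hc'.trans (N.evNF_skip_comp_mapF_lift r a b).symm⟩
  | _, _, _, _, .skip a, .skip b => by
    obtain ⟨c, hc, hc'⟩ := NF.exists_comp M s N r (.skip a) b
    exact ⟨.skip c, (congrArg (· ≫ _) hc).trans (Category.assoc _ _ _),
      (congrArg (· ≫ _) hc').trans (Category.assoc _ _ _)⟩
-- The `lift` case enlarges the second argument while shrinking the first, whence the lexicographic
-- order with `a` first.
termination_by _ _ _ _ a b => (sizeOf a, sizeOf b)


/-! ## The action of an adjoint pair on hom-categories -/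

section

variable {C : Type u} [Bicategory.{w, v} C] {o : AdjObj → C} {f : o zero ⟶ o one}
  {fv : o one ⟶ o zero}

/-- The value of a generating 1-morphism. -/
def Gen.val (f : o zero ⟶ o one) (fv : o one ⟶ o zero) : {j k : AdjObj} → Gen j k → (o j ⟶ o k)
  | _, _, .V => fv
  | _, _, .F => f

/-- An adjoint pair acts on the categories of 1-morphisms from a fixed object. -/
def AdjModule.ofAdjunction (A : Bicategory.Adjunction fv f) (x : C) : AdjModule.{w, v} where
  X j := (x ⟶ o j)
  act e := postcomp x (e.val f fv)
  adj :=
    { unit :=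
        { app h := (ρ_ h).inv ≫ h ◁ A.unit ≫ (α_ h fv f).inv
          naturality := fun h h' η => by
            show η ≫ (ρ_ h').inv ≫ h' ◁ A.unit ≫ (α_ h' fv f).inv =
              ((ρ_ h).inv ≫ h ◁ A.unit ≫ (α_ h fv f).inv) ≫ (η ▷ fv) ▷ f
            simp only [Category.assoc, ← associator_inv_naturality_left, whisker_exchange_assoc]
            simp }
      counit :=
        { app h := (α_ h f fv).hom ≫ h ◁ A.counit ≫ (ρ_ h).hom
          naturality := fun h h' η => by
            show (η ▷ f) ▷ fv ≫ (α_ h' f fv).hom ≫ h' ◁ A.counit ≫ (ρ_ h').hom =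
              ((α_ h f fv).hom ≫ h ◁ A.counit ≫ (ρ_ h).hom) ≫ η
            simp only [Category.assoc, associator_naturality_left_assoc,
              ← whisker_exchange_assoc]
            simp }
      left_triangle_components := fun h => by
        show ((ρ_ h).inv ≫ h ◁ A.unit ≫ (α_ h fv f).inv) ▷ fv ≫
          (α_ (h ≫ fv) f fv).hom ≫ (h ≫ fv) ◁ A.counit ≫ (ρ_ (h ≫ fv)).hom = 𝟙 (h ≫ fv)
        calc _ = 𝟙 _ ⊗≫ h ◁ leftZigzag A.unit A.counit ⊗≫ 𝟙 _ := by
              dsimp only [leftZigzag]; bicategory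
          _ = _ := by rw [A.left_triangle]; bicategory
      right_triangle_components := fun h => by
        show ((ρ_ (h ≫ f)).inv ≫ (h ≫ f) ◁ A.unit ≫ (α_ (h ≫ f) fv f).inv) ≫
          ((α_ h f fv).hom ≫ h ◁ A.counit ≫ (ρ_ h).hom) ▷ f = 𝟙 (h ≫ f)
        calc _ = 𝟙 _ ⊗≫ h ◁ rightZigzag A.unit A.counit ⊗≫ 𝟙 _ := by
              dsimp only [rightZigzag]; bicategory
          _ = _ := by rw [A.right_triangle]; bicategory }

end

/-! ## The universal adjoint pair -/

/-- Both triangle identities of the universal pair compare maps into one-element ordinals, so they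
hold for free. -/
theorem twoCell_ext_of_size_le_one {i j : AdjObj} {t t' : OneCell i j} (h : t'.size ≤ 1)
    (η θ : t ⟶ t') : η = θ :=
  twoCell_ext fun x => by
    have h1 := (η.toMap x).isLt
    have h2 := (θ.toMap x).isLt
    omega

/-- The universal adjoint pair, as an adjunction. -/
def univAdj : Bicategory.Adjunction univ.fv univ.f where
  unit := univ.av
  counit := univ.a
  left_triangle := twoCell_ext_of_size_le_one (le_refl 1) _ _
  right_triangle := twoCell_ext_of_size_le_one (le_refl 1) _ _

/-- The module `adj(i, -)`. -/
abbrev reprModule (i : AdjObj) : AdjModule.{0, 0} :=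
  AdjModule.ofAdjunction (o := fun j => j) univAdj i

/-- The 1-morphism of `adj` represented by a word. -/
abbrev real {i j : AdjObj} (t : Word i j) : i ⟶ j := (reprModule i).ev (𝟙 i) t

/-- The 2-morphism of `adj` represented by a normal form. -/
abbrev realNF {i j : AdjObj} {t t' : Word i j} (a : NF t t') : real t ⟶ real t' :=
  (reprModule i).evNF (𝟙 i) a

/-- The generating 1-morphisms as 1-morphisms of `adj`. -/
abbrev Gen.cell {j k : AdjObj} (e : Gen j k) : j ⟶ k := e.val (o := fun j => j) univ.f univ.fv

theorem real_size_cons_V {i : AdjObj} (t : Word i one) :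
    OneCell.size (real (t.cons .V)) = OneCell.size (real t) + 1 := rfl

theorem real_size_cons_F {i : AdjObj} (t : Word i zero) :
    OneCell.size (real (t.cons .F)) = OneCell.size (real t) := rfl

/-- The unit is the inclusion that adds a new last element. Hence `skip` describes exactly a map
that misses the last element. -/
theorem unit_toMap {i : AdjObj} (t : i ⟶ one) (x : Fin (OneCell.size t)) :
    (TwoCell.toMap ((reprModule i).adj.unit.app t) x).val = x.val := by
  show (TwoCell.toMap ((ρ_ t).inv ≫ t ◁ univAdj.unit ≫ (α_ t univ.fv univ.f).inv) x).val = x.val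
  rw [comp_toMap, comp_toMap]
  show (TwoCell.toMap (t ◁ univAdj.unit) _).val = _
  exact hcomp_left _ _ _ x rfl

theorem realNF_mapF_toMap {i : AdjObj} {t t' : Word i zero} (a : NF t t')
    (x : Fin (OneCell.size (real t))) :
    (TwoCell.toMap (realNF (.mapF a)) x).val = (TwoCell.toMap (realNF a) x).val :=
  hcomp_left _ _ _ x rfl

theorem realNF_skip_toMap {i : AdjObj} {t t' : Word i one} (a : NF t t')
    (x : Fin (OneCell.size (real t))) :
    (TwoCell.toMap (realNF (.skip a)) x).val = (TwoCell.toMap (realNF a) x).val :=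
  unit_toMap (real t') _


/-! ## Normal forms of 2-morphisms are unique and exist -/

theorem toMap_val_of_eq {i j : AdjObj} {t t' : i ⟶ j} {η θ : t ⟶ t'} (h : η = θ)
    (x : Fin (OneCell.size t)) : (TwoCell.toMap η x).val = (TwoCell.toMap θ x).val := by
  rw [h]

/-- Maps into the object `0` preserve the last element, so `mapF a` hits the last element of the
target, while `skip b` misses it. -/
theorem realNF_mapF_ne_skip {i : AdjObj} {s : Word i zero} {t : Word i one}
    (a : NF s (t.cons .V)) (b : NF (s.cons .F) t) : realNF (.mapF a) ≠ realNF (.skip b) := by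
  intro h
  have hs : 0 < OneCell.size (real s) := OneCell.pos_right (real s) rfl
  let x : Fin (OneCell.size (real s)) := ⟨OneCell.size (real s) - 1, by omega⟩
  have h0 := toMap_val_of_eq h x
  have h1 := realNF_mapF_toMap a x
  have h2 := realNF_skip_toMap b x
  have h3 := TwoCell.map_last (realNF a) rfl x (by show _ - 1 + 1 = _; omega)
  have h4 := (TwoCell.toMap (realNF b) x).isLt
  have h5 := real_size_cons_V t
  omega

/-- Transposition is bijective, `mapF` and `skip` leave the values of the map unchanged, and the
only two constructors that can compete are separated by the last element. -/
theorem realNF_injective : ∀ {i j : AdjObj} {t t' : Word i j} (a b : NF t t'),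
    realNF a = realNF b → a = b
  | _, _, _, _, .nil, .nil, _ => rfl
  | _, _, _, _, .lift a, .lift b, h => by
    rw [realNF_injective a b (Equiv.injective _ h)]
  | _, _, _, _, .mapF a, .mapF b, h => by
    rw [realNF_injective a b (twoCell_ext fun x => by
      rw [← realNF_mapF_toMap, ← realNF_mapF_toMap, h])]
  | _, _, _, _, .skip a, .skip b, h => by
    rw [realNF_injective a b (twoCell_ext fun x =>
      (realNF_skip_toMap a x).symm.trans ((toMap_val_of_eq h x).trans (realNF_skip_toMap b x)))]
  | _, _, _, _, .mapF a, .skip b, h => (realNF_mapF_ne_skip a b h).elim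
  | _, _, _, _, .skip b, .mapF a, h => (realNF_mapF_ne_skip a b h.symm).elim

/-- A monotone map between words that end with `f` and which preserves the last element. -/
def restrictF {i : AdjObj} {s t : Word i zero} (θ : real (s.cons .F) ⟶ real (t.cons .F))
    (h : ∀ x : Fin (OneCell.size (real s)), x.val + 1 = OneCell.size (real s) →
      (TwoCell.toMap θ x).val + 1 = OneCell.size (real t)) : real s ⟶ real t :=
  (⟨show Fin (OneCell.size (real (s.cons .F))) →o Fin (OneCell.size (real (t.cons .F))) from
    TwoCell.toMap θ, fun hi x hx => TwoCell.map_first θ hi x hx, fun _ x hx => h x hx⟩ :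
    TwoCell (real s) (real t))

/-- A monotone map which does not hit the last element. -/
def corestrict {i : AdjObj} {s t : Word i one} (θ : real s ⟶ real ((t.cons .V).cons .F))
    (h : ∀ x, (TwoCell.toMap θ x).val < OneCell.size (real t)) : real s ⟶ real t :=
  (⟨⟨fun x => ⟨(TwoCell.toMap θ x).val, h x⟩, fun _ _ hxy => (TwoCell.toMap θ).monotone hxy⟩,
    fun hi x hx => TwoCell.map_first θ hi x hx, fun hj => AdjObj.noConfusion hj⟩ :
    TwoCell (real s) (real t))

/-- The length of a word. -/
def Word.length {i : AdjObj} : {j : AdjObj} → Word i j → ℕ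
  | _, .nil => 0
  | _, .cons t _ => t.length + 1

/-- Outer induction on the source word, inner induction on the length of the target: `lift` and
`mapF` shorten the source, whereas `skip` keeps the source and shortens the target. -/
theorem realNF_surjective {i j : AdjObj} (t t' : Word i j) (θ : real t ⟶ real t') :
    ∃ a : NF t t', realNF a = θ := by
  induction t with
  | nil =>
    generalize hn : t'.length = n
    induction n using Nat.strong_induction_on generalizing t' with
    | _ n ih =>
    match i, t', θ, hn, ih with
    | zero, .nil, θ, _, _ => exact ⟨.nil, twoCell_ext_of_size_le_one (le_refl 1) _ _⟩
    | one, .nil, θ, _, _ => exact ⟨.nil, twoCell_ext_of_size_le_one (Nat.zero_le 1) _ _⟩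
    | zero, .cons (.cons t .F) .V, θ, _, _ =>
      -- A map from a one-element ordinal that preserves both ends forces a one-element target, but
      -- this target has at least two elements.
      exfalso
      have h1 := TwoCell.map_first θ rfl (0 : Fin 1) rfl
      have h2 := TwoCell.map_last θ rfl (0 : Fin 1) rfl
      have h3 := real_size_cons_V (t.cons .F)
      have h4 := real_size_cons_F t
      have h5 : 0 < OneCell.size (real t) := OneCell.pos_right (real t) rfl
      omega
    | one, .cons (.cons t .V) .F, θ, hn, ih =>
      obtain ⟨a, ha⟩ := ih t.length (by rw [← hn]; simp only [Word.length]; omega) t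
        (fromEmpty _) rfl
      exact ⟨.skip a, twoCell_ext fun x => Fin.elim0 x⟩
  | cons s e ih =>
    cases e with
    | V =>
      obtain ⟨a, ha⟩ := ih (t'.cons .F) ((reprModule i).adj.homEquiv _ _ θ)
      refine ⟨.lift a, ?_⟩
      exact (Equiv.symm_apply_eq _).2 ha
    | F =>
      generalize hn : t'.length = n
      induction n using Nat.strong_induction_on generalizing t' with
      | _ n ih' =>
      have hs : 0 < OneCell.size (real s) := OneCell.pos_right (real s) rfl
      cases t' with
      -- Here the target is the empty ordinal, while the source is nonempty.
      | nil => exact (TwoCell.toMap θ ⟨0, hs⟩).elim0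
      | cons t e =>
      cases e with
      | F =>
      by_cases h : (TwoCell.toMap θ ⟨OneCell.size (real s) - 1, Nat.sub_lt hs one_pos⟩).val + 1 =
          OneCell.size (real t)
      · obtain ⟨a, ha⟩ := ih t (restrictF θ fun x hx => by
          rw [← h]
          exact congrArg (· + 1) (toMap_congr θ (show x.val = OneCell.size (real s) - 1 by omega)))
        exact ⟨.mapF a, twoCell_ext fun x => 
          (realNF_mapF_toMap a x).trans (toMap_val_of_eq ha x)⟩
      · have hlt := (TwoCell.toMap θ ⟨OneCell.size (real s) - 1, Nat.sub_lt hs one_pos⟩).isLt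
        have hFt := real_size_cons_F t
        cases t with
        | nil =>
          exfalso
          have h1 : OneCell.size (real (Word.nil : Word zero zero)) = 1 := rfl
          omega
        | cons t e =>
        cases e with
        | V =>
        have hVt := real_size_cons_V t
        -- By monotonicity, if the last element of the source is not sent to the last element of the
        -- target, then nothing is.
        have hθ : ∀ x, (TwoCell.toMap θ x).val < OneCell.size (real t) := fun x => by
          have hx : x ≤ ⟨OneCell.size (real s) - 1, Nat.sub_lt hs one_pos⟩ := by
            have h1 : x.val < OneCell.size (real s) := x.isLt
            show x.val ≤ OneCell.size (real s) - 1
            omega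
          have h1 : (TwoCell.toMap θ x).val ≤ _ := (TwoCell.toMap θ).monotone hx
          omega
        obtain ⟨a, ha⟩ := ih' t.length (by rw [← hn]; simp only [Word.length]; omega) t
          (corestrict θ hθ) rfl
        exact ⟨.skip a, twoCell_ext fun x => 
          (realNF_skip_toMap a x).trans (toMap_val_of_eq ha x)⟩


/-! ## Evaluation of 2-morphisms -/

namespace AdjModule

section

variable (M : AdjModule.{v, u}) {i : AdjObj} (s : M.X i)

/-- The action of a 2-morphism of `adj` between words on a base point. -/
noncomputable def evMap {j : AdjObj} {t t' : Word i j} (θ : real t ⟶ real t') :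
    M.ev s t ⟶ M.ev s t' :=
  M.evNF s (realNF_surjective t t' θ).choose

/-- Uniqueness of normal forms makes the evaluation independent of the chosen one. -/
theorem evMap_realNF {j : AdjObj} {t t' : Word i j} (a : NF t t') :
    M.evMap s (realNF a) = M.evNF s a :=
  congrArg (M.evNF s) (realNF_injective _ _ (realNF_surjective t t' (realNF a)).choose_spec)

theorem evMap_id {j : AdjObj} (t : Word i j) : M.evMap s (𝟙 (real t)) = 𝟙 _ := by
  obtain ⟨a, h, h'⟩ := NF.exists_id M s (reprModule i) (𝟙 i) t
  rw [← h, ← evMap_realNF]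
  exact congrArg _ h'.symm

/-- The second module of `NF.exists_comp` is `adj(i, -)`, where the composite normal form represents
`θ ≫ θ'`. -/
theorem evMap_comp {j : AdjObj} {t t' t'' : Word i j} (θ : real t ⟶ real t')
    (θ' : real t' ⟶ real t'') : M.evMap s (θ ≫ θ') = M.evMap s θ ≫ M.evMap s θ' := by
  obtain ⟨a, rfl⟩ := realNF_surjective _ _ θ
  obtain ⟨b, rfl⟩ := realNF_surjective _ _ θ'
  obtain ⟨c, h, h'⟩ := NF.exists_comp M s (reprModule i) (𝟙 i) a b
  rw [evMap_realNF, evMap_realNF, ← h, ← evMap_realNF]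
  exact congrArg _ h'.symm

theorem evMap_unit (t : Word i one) :
    M.evMap s (t' := (t.cons .V).cons .F) ((reprModule i).adj.unit.app (real t)) =
      M.adj.unit.app (M.ev s t) := by
  obtain ⟨a, h, h'⟩ := NF.exists_id M s (reprModule i) (𝟙 i) t
  have e1 : realNF (.skip a) = (reprModule i).adj.unit.app (real t) :=
    (congrArg (· ≫ _) h').trans (Category.id_comp _)
  have e2 : M.evNF s (.skip a) = M.adj.unit.app (M.ev s t) :=
    (congrArg (· ≫ _) h).trans (Category.id_comp _)
  rw [← e1, ← e2, evMap_realNF]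

theorem evMap_counit (t : Word i zero) :
    M.evMap s (t := (t.cons .F).cons .V) ((reprModule i).adj.counit.app (real t)) =
      M.adj.counit.app (M.ev s t) := by
  obtain ⟨a, h, h'⟩ := NF.exists_id M s (reprModule i) (𝟙 i) (t.cons .F)
  have e1 : realNF (.lift a) = (reprModule i).adj.counit.app (real t) :=
    (congrArg _ h').trans ((reprModule i).adj.homEquiv_symm_id _)
  have e2 : M.evNF s (.lift a) = M.adj.counit.app (M.ev s t) :=
    (congrArg _ h).trans (M.adj.homEquiv_symm_id _)
  rw [← e1, ← e2, evMap_realNF]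

/-- The action of `f^∨` on morphisms is not a constructor; naturality of the unit expresses it as
the transpose of `a` followed by a unit. -/
theorem evNF_lift_skip {t t' : Word i one} (a : NF t t') :
    M.evNF s (.lift (.skip a)) = (M.act .V).map (M.evNF s a) :=
  (Equiv.symm_apply_eq _).2 ((M.adj.unit.naturality (M.evNF s a)).trans
    (M.adj.homEquiv_unit _ _ _).symm)

theorem evMap_act {j k : AdjObj} (e : Gen j k) {t t' : Word i j} (θ : real t ⟶ real t') :
    M.evMap s (t := t.cons e) (t' := t'.cons e) (((reprModule i).act e).map θ) =
      (M.act e).map (M.evMap s θ) := by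
  obtain ⟨a, rfl⟩ := realNF_surjective _ _ θ
  rw [evMap_realNF]
  cases e with
  | F => exact M.evMap_realNF s (.mapF a)
  | V =>
    rw [← evNF_lift_skip, ← evMap_realNF]
    exact congrArg _ ((reprModule i).evNF_lift_skip (𝟙 i) a).symm

/-- The action of an invertible 2-morphism of `adj` between words on a base point. -/
@[simps]
noncomputable def evMapIso {j : AdjObj} {t t' : Word i j} (θ : real t ≅ real t') :
    M.ev s t ≅ M.ev s t' where
  hom := M.evMap s θ.hom
  inv := M.evMap s θ.inv
  hom_inv_id := by rw [← evMap_comp, θ.hom_inv_id, evMap_id]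
  inv_hom_id := by rw [← evMap_comp, θ.inv_hom_id, evMap_id]

end

/-! ## Morphisms of modules -/

/-- Functors that commute with the actions and are compatible with the adjunctions. -/
structure Hom (M : AdjModule.{v, u}) (N : AdjModule.{v₁, u₁}) where
  F : ∀ j, M.X j ⥤ N.X j
  iso : ∀ {j k : AdjObj} (e : Gen j k), M.act e ⋙ F k ≅ F j ⋙ N.act e
  unit : ∀ x : M.X one, (F one).map (M.adj.unit.app x) ≫ (iso .F).hom.app _ ≫
    (N.act .F).map ((iso .V).hom.app x) = N.adj.unit.app ((F one).obj x)
  counit : ∀ x : M.X zero, (F zero).map (M.adj.counit.app x) = (iso .V).hom.app _ ≫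
    (N.act .V).map ((iso .F).hom.app x) ≫ N.adj.counit.app ((F zero).obj x)

namespace Hom

variable {M : AdjModule.{v, u}} {N : AdjModule.{v₁, u₁}} (Φ : Hom M N) {i : AdjObj} {s : M.X i}
  {r : N.X i} (σ : (Φ.F i).obj s ≅ r)

/-- Morphisms of modules commute with the action of words. -/
def evIso : {j : AdjObj} → (t : Word i j) → ((Φ.F j).obj (M.ev s t) ≅ N.ev r t)
  | _, .nil => σ
  | _, .cons t e => (Φ.iso e).app (M.ev s t) ≪≫ (N.act e).mapIso (evIso t)

theorem evIso_cons_hom {j k : AdjObj} (t : Word i j) (e : Gen j k) :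
    (Φ.evIso σ (t.cons e)).hom =
      (Φ.iso e).hom.app (M.ev s t) ≫ (N.act e).map (Φ.evIso σ t).hom := rfl

/-- Compatibility with counits implies compatibility with transposition. This is the `lift` case of
`evIso_naturality_NF`; `map_skip_comp` is the `skip` case and uses the units. -/
theorem map_lift_comp {x : M.X one} {y : M.X zero} (g : x ⟶ (M.act .F).obj y)
    {x' : N.X one} {y' : N.X zero} (g' : x' ⟶ (N.act .F).obj y') (c : (Φ.F one).obj x ⟶ x')
    (d : (Φ.F zero).obj y ⟶ y')
    (h : (Φ.F one).map g ≫ (Φ.iso .F).hom.app y ≫ (N.act .F).map d = c ≫ g') :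
    (Φ.F zero).map ((M.adj.homEquiv x y).symm g) ≫ d =
      ((Φ.iso .V).hom.app x ≫ (N.act .V).map c) ≫ (N.adj.homEquiv x' y').symm g' := by
  have h1 := (Φ.iso .V).hom.naturality g
  simp only [Functor.comp_map] at h1
  rw [CategoryTheory.Adjunction.homEquiv_counit, CategoryTheory.Adjunction.homEquiv_counit,
    Functor.map_comp, Φ.counit, Category.assoc, Category.assoc, Category.assoc, Category.assoc,
    reassoc_of% h1, ← Functor.map_comp_assoc (N.act .V) c g', ← h,
    ← N.adj.counit_naturality d]
  simp only [Functor.map_comp, Category.assoc]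

theorem map_skip_comp {x y : M.X one} (g : x ⟶ y) {x' y' : N.X one} (g' : x' ⟶ y')
    (c : (Φ.F one).obj x ⟶ x') (d : (Φ.F one).obj y ⟶ y')
    (h : (Φ.F one).map g ≫ d = c ≫ g') :
    (Φ.F one).map (g ≫ M.adj.unit.app y) ≫ (Φ.iso .F).hom.app _ ≫
      (N.act .F).map ((Φ.iso .V).hom.app y ≫ (N.act .V).map d) =
        c ≫ g' ≫ N.adj.unit.app y' := by
  have h1 := N.adj.unit.naturality d
  simp only [Functor.id_obj, Functor.id_map, Functor.comp_map] at h1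
  rw [← reassoc_of% h, h1, ← Φ.unit]
  simp only [Functor.map_comp, Category.assoc]

theorem evIso_naturality_NF {j : AdjObj} {t t' : Word i j} (a : NF t t') :
    (Φ.F j).map (M.evNF s a) ≫ (Φ.evIso σ t').hom = (Φ.evIso σ t).hom ≫ N.evNF r a := by
  induction a with
  | nil =>
    show (Φ.F i).map (𝟙 s) ≫ σ.hom = σ.hom ≫ 𝟙 r
    rw [CategoryTheory.Functor.map_id, Category.id_comp, Category.comp_id]
  | lift a ih => exact Φ.map_lift_comp _ _ _ _ ih
  | mapF a ih =>
    have h1 := (Φ.iso .F).hom.naturality (M.evNF s a)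
    have h2 := congrArg (N.act .F).map ih
    rw [CategoryTheory.Functor.map_comp, CategoryTheory.Functor.map_comp] at h2
    rw [evIso_cons_hom, evIso_cons_hom]
    exact (((Category.assoc _ _ _).symm.trans (congrArg (· ≫ _) h1)).trans
      (Category.assoc _ _ _)).trans ((congrArg (_ ≫ ·) h2).trans (Category.assoc _ _ _).symm)
  | skip a ih => exact Φ.map_skip_comp _ _ _ _ ih

theorem evIso_naturality {i : AdjObj} (Φ : Hom (reprModule i) N) {r : N.X i}
    (σ : (Φ.F i).obj (𝟙 i) ≅ r) {j : AdjObj} {t t' : Word i j} (θ : real t ⟶ real t') :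
    (Φ.F j).map θ ≫ (Φ.evIso σ t').hom = (Φ.evIso σ t).hom ≫ N.evMap r θ := by
  obtain ⟨a, rfl⟩ := realNF_surjective _ _ θ
  rw [evMap_realNF]
  exact Φ.evIso_naturality_NF σ a

end Hom

end AdjModule


/-! ## Every 1-morphism of `adj` is a word -/

/-- Words alternate between the two ends, so both statements are proved together. Appending `f^∨`
adds one element and appending `f` adds none, whence `n` at `1` against `n + 1` at `0`. -/
theorem exists_real_aux {i : AdjObj} (n : ℕ) :
    (∀ t : OneCell i one, t.size = n → ∃ t' : Word i one, real t' = t) ∧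
      ∀ t : OneCell i zero, t.size = n + 1 → ∃ t' : Word i zero, real t' = t := by
  have step : ∀ n, (∀ t : OneCell i one, t.size = n → ∃ t' : Word i one, real t' = t) →
      ∀ t : OneCell i zero, t.size = n + 1 → ∃ t' : Word i zero, real t' = t := by
    intro n hn t ht
    by_cases hi : i = zero ∧ n = 0
    -- The identity of `0` is the one case in which `f^∨` cannot be removed: the remaining
    -- 1-morphism from `0` to `1` would be empty.
    · obtain ⟨rfl, rfl⟩ := hi
      exact ⟨.nil, OneCell.ext ht.symm⟩
    · obtain ⟨t', ht'⟩ := hn ⟨n, fun h => Nat.pos_of_ne_zero fun h' => hi ⟨h, h'⟩,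
        fun h => AdjObj.noConfusion h⟩ rfl
      refine ⟨t'.cons .V, OneCell.ext ?_⟩
      rw [real_size_cons_V, ht', ht]
  induction n with
  | zero =>
    have h0 : ∀ t : OneCell i one, t.size = 0 → ∃ t' : Word i one, real t' = t := by
      intro t ht
      cases i with
      | zero => exact absurd (t.pos_left rfl) (by omega)
      | one => exact ⟨.nil, OneCell.ext ht.symm⟩
    exact ⟨h0, step 0 h0⟩
  | succ n ih =>
    have h1 : ∀ t : OneCell i one, t.size = n + 1 → ∃ t' : Word i one, real t' = t := by
      intro t ht
      obtain ⟨t', ht'⟩ := ih.2 ⟨n + 1, fun _ => n.succ_pos, fun _ => n.succ_pos⟩ rfl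
      refine ⟨t'.cons .F, OneCell.ext ?_⟩
      rw [real_size_cons_F, ht', ht]
    exact ⟨h1, step _ h1⟩

theorem exists_real {i j : AdjObj} (t : i ⟶ j) : ∃ t' : Word i j, real t' = t := by
  cases j with
  | one => exact (exists_real_aux _).1 t rfl
  | zero =>
    exact (exists_real_aux (OneCell.size t - 1)).2 t
      (Nat.sub_add_cancel (OneCell.pos_right t rfl)).symm

theorem oneCell_induction {i : AdjObj} {P : ∀ j : AdjObj, (i ⟶ j) → Prop} (nil : P i (𝟙 i))
    (cons : ∀ (j k : AdjObj) (t : i ⟶ j) (e : Gen j k), P j t → P k (t ≫ e.cell))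
    {j : AdjObj} (t : i ⟶ j) : P j t := by
  obtain ⟨t, rfl⟩ := exists_real t
  induction t with
  | nil => exact nil
  | cons t e ih => exact cons _ _ _ e ih

/-- A word that represents the given 1-morphism. -/
noncomputable def word {i j : AdjObj} (t : i ⟶ j) : Word i j := (exists_real t).choose

/-- The given 1-morphism is represented by its word. -/
noncomputable def realWordIso {i j : AdjObj} (t : i ⟶ j) : real (word t) ≅ t :=
  eqToIso (exists_real t).choose_spec

/-- The `conj` lemmas show that conjugation by the isomorphisms to chosen words respects identities,
composites, the action, units and counits. They are what `Hom.ofPoint` needs to pass from words to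
arbitrary 1-morphisms. -/
theorem conj_id {D : Type u} [Category.{v} D] {x y : D} (κ : x ≅ y) :
    κ.hom ≫ 𝟙 y ≫ κ.inv = 𝟙 x := by simp

theorem conj_comp {D : Type u} [Category.{v} D] {x x' x'' y y' y'' : D} (κ : x ≅ y)
    (κ' : x' ≅ y') (κ'' : x'' ≅ y'') (θ : y ⟶ y') (θ' : y' ⟶ y'') :
    κ.hom ≫ (θ ≫ θ') ≫ κ''.inv = (κ.hom ≫ θ ≫ κ'.inv) ≫ κ'.hom ≫ θ' ≫ κ''.inv := by simp

theorem conj_map {D : Type u} [Category.{v} D] {E : Type u₁} [Category.{v₁} E] (G : D ⥤ E)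
    {x x' y y' : D} (κ : x ≅ y) (κ' : x' ≅ y') (θ : y ⟶ y') {z z' : E} (μ : z ≅ G.obj y)
    (μ' : z' ≅ G.obj y') :
    (μ.hom ≫ G.map θ ≫ μ'.inv) ≫ μ'.hom ≫ G.map κ'.inv =
      (μ.hom ≫ G.map κ.inv) ≫ G.map (κ.hom ≫ θ ≫ κ'.inv) := by
  simp [← Functor.map_comp]

theorem conj_unit {D : Type u} [Category.{v} D] {E : Type u₁} [Category.{v₁} E] {L : D ⥤ E}
    {R : E ⥤ D} (A : CategoryTheory.Adjunction L R) {x y : D} (κ : x ≅ y) {z : E}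
    (μ : z ≅ L.obj y) {t : D} (ν : t ≅ R.obj (L.obj y)) :
    (κ.hom ≫ A.unit.app y ≫ ν.inv) ≫ (ν.hom ≫ R.map μ.inv) ≫ R.map (μ.hom ≫ L.map κ.inv) =
      A.unit.app x := by
  have h := A.unit.naturality κ.inv
  simp only [Functor.id_obj, Functor.id_map, Functor.comp_map, Functor.comp_obj] at h
  simp [← h]

theorem conj_counit {D : Type u} [Category.{v} D] {E : Type u₁} [Category.{v₁} E] {L : D ⥤ E}
    {R : E ⥤ D} (A : CategoryTheory.Adjunction L R) {x y : E} (κ : x ≅ y) {z : D}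
    (μ : z ≅ R.obj y) {t : E} (ν : t ≅ L.obj (R.obj y)) :
    ν.hom ≫ A.counit.app y ≫ κ.inv =
      (ν.hom ≫ L.map μ.inv) ≫ L.map (μ.hom ≫ R.map κ.inv) ≫ A.counit.app x := by
  simp [← Functor.map_comp_assoc]

namespace AdjModule

/-! ## The modules `adj(i, -)` are free on one generator -/

section

variable (M : AdjModule.{v, u}) {i : AdjObj} (s : M.X i)

/-- The functors underlying `Hom.ofPoint`. -/
noncomputable def ofPointF (j : AdjObj) : (reprModule i).X j ⥤ M.X j where
  obj t := M.ev s (word t)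
  map {t t'} θ := M.evMap s ((realWordIso t).hom ≫ (show t ⟶ t' from θ) ≫ (realWordIso t').inv)
  map_id t := by
    rw [← evMap_id]
    exact congrArg _ (conj_id _)
  map_comp {t t' t''} θ θ' := by
    rw [← evMap_comp]
    exact congrArg _ (conj_comp _ _ _ _ _)

/-- The isomorphism between the two words that represent the image of a 1-morphism under the
action of a generator. -/
noncomputable def wordConsIso {j k : AdjObj} (e : Gen j k) (t : (reprModule i).X j) :
    real (word (((reprModule i).act e).obj t)) ≅ real ((word t).cons e) :=
  realWordIso (((reprModule i).act e).obj t) ≪≫ ((reprModule i).act e).mapIso (realWordIso t).symm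

/-- The functors `ofPointF` commute with the actions. -/
noncomputable def ofPointNatIso {j k : AdjObj} (e : Gen j k) :
    (reprModule i).act e ⋙ M.ofPointF s k ≅ M.ofPointF s j ⋙ M.act e :=
  NatIso.ofComponents (fun t => M.evMapIso s (wordConsIso e t)) (fun {t t'} θ => by
    refine .trans ?_ (congrArg (_ ≫ ·) (M.evMap_act s e
      ((realWordIso t).hom ≫ θ ≫ (realWordIso t').inv)))
    exact (M.evMap_comp s _ (wordConsIso e t').hom).symm.trans
      ((congrArg _ (conj_map ((reprModule i).act e) (realWordIso t) _ _ _ _)).trans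
        (M.evMap_comp s (wordConsIso e t).hom _)))

/-- The morphism from `adj(i, -)` with the given value at the identity. -/
noncomputable def Hom.ofPoint : Hom (reprModule i) M where
  F j := M.ofPointF s j
  iso e := M.ofPointNatIso s e
  unit t := by
    refine .trans (congrArg (fun z => _ ≫ _ ≫ z) (M.evMap_act s .F (wordConsIso .V t).hom).symm) ?_
    refine .trans (congrArg (_ ≫ ·) (M.evMap_comp s
      (t'' := ((word t).cons .V).cons .F) (wordConsIso .F (((reprModule i).act .V).obj t)).hom
      (((reprModule i).act .F).map (wordConsIso .V t).hom)).symm) ?_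
    refine .trans (M.evMap_comp s (t'' := ((word t).cons .V).cons .F) _ _).symm ?_
    exact .trans (congrArg _ (conj_unit (reprModule i).adj _ _ _)) (M.evMap_unit s _)
  counit t := by
    refine .trans (congrArg (M.evMap s) (conj_counit (reprModule i).adj (realWordIso t)
      (realWordIso (((reprModule i).act .F).obj t)) _)) ?_
    refine .trans (M.evMap_comp s (t'' := word t)
      (wordConsIso .V (((reprModule i).act .F).obj t)).hom (((reprModule i).act .V).map (wordConsIso .F t).hom ≫
        (reprModule i).adj.counit.app (real (word t)))) (congrArg (_ ≫ ·) ?_)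
    refine .trans (M.evMap_comp s
      (t := (word (((reprModule i).act .F).obj t)).cons .V) (t' := ((word t).cons .F).cons .V)
      (((reprModule i).act .V).map (wordConsIso .F t).hom)
      ((reprModule i).adj.counit.app (real (word t)))) ?_
    rw [evMap_counit]
    exact congrArg (· ≫ _) (M.evMap_act s .V (wordConsIso .F t).hom)

/-- The value of `Hom.ofPoint` at the identity. -/
noncomputable def Hom.ofPointIso : ((Hom.ofPoint M s).F i).obj (𝟙 i) ≅ s :=
  M.evMapIso s (t' := .nil) (realWordIso (𝟙 i))

end

namespace Hom

variable {N : AdjModule.{v, u}} {i : AdjObj} {Φ Ψ : Hom (reprModule i) N}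

/-- Isomorphisms of morphisms of modules. -/
structure Iso {M : AdjModule.{v, u}} {N : AdjModule.{v₁, u₁}} (Φ Ψ : Hom M N) where
  app : ∀ j, Φ.F j ≅ Ψ.F j
  comm : ∀ {j k : AdjObj} (e : Gen j k) (x : M.X j),
    (app k).hom.app ((M.act e).obj x) ≫ (Ψ.iso e).hom.app x =
      (Φ.iso e).hom.app x ≫ (N.act e).map ((app j).hom.app x)

/-- The component of `isoOfBase`. -/
noncomputable def isoOfBaseApp (σ : (Φ.F i).obj (𝟙 i) ≅ (Ψ.F i).obj (𝟙 i)) {j : AdjObj}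
    (t : (reprModule i).X j) : (Φ.F j).obj t ≅ (Ψ.F j).obj t :=
  (Φ.F j).mapIso (realWordIso t).symm ≪≫ Φ.evIso σ (word t) ≪≫
    (Ψ.evIso (_root_.CategoryTheory.Iso.refl _) (word t)).symm ≪≫ (Ψ.F j).mapIso (realWordIso t)

theorem square_comp {D : Type u} [Category.{v} D] {x x' y y' z z' : D} {f : x ⟶ x'}
    {g : y ⟶ y'} {h : z ⟶ z'} {c : x ⟶ y} {c' : x' ⟶ y'} (d : z ≅ y) (d' : z' ≅ y')
    (h1 : f ≫ c' = c ≫ g) (h2 : h ≫ d'.hom = d.hom ≫ g) :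
    f ≫ c' ≫ d'.inv = (c ≫ d.inv) ≫ h := by
  rw [← cancel_mono d'.hom]
  simp [h1, h2]

/-- By naturality of `evIso`, any word representing a 1-morphism gives the same component, so the
chosen word may be replaced by `t`. -/
theorem isoOfBaseApp_real (σ : (Φ.F i).obj (𝟙 i) ≅ (Ψ.F i).obj (𝟙 i)) {j : AdjObj}
    (t : Word i j) : (isoOfBaseApp σ (real t)).hom = (Φ.evIso σ t).hom ≫
      (Ψ.evIso (_root_.CategoryTheory.Iso.refl _) t).inv := by
  have h := square_comp _ _ (Φ.evIso_naturality σ (realWordIso (real t)).inv)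
    (Ψ.evIso_naturality (_root_.CategoryTheory.Iso.refl _) (realWordIso (real t)).inv)
  have h' : (isoOfBaseApp σ (real t)).hom = ((Φ.F j).map (realWordIso (real t)).inv ≫
    (Φ.evIso σ (word (real t))).hom ≫
      (Ψ.evIso (_root_.CategoryTheory.Iso.refl _) (word (real t))).inv) ≫
        (Ψ.F j).map (realWordIso (real t)).hom :=
    (congrArg (_ ≫ ·) (Category.assoc _ _ _).symm).trans (Category.assoc _ _ _).symm
  rw [h', h, Category.assoc]
  refine (congrArg (_ ≫ ·) ?_).trans (Category.comp_id _)
  exact ((Ψ.F j).map_comp _ _).symm.trans ((congrArg _ (Iso.inv_hom_id _)).trans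
    ((Ψ.F j).map_id _))

theorem isoOfBaseApp_naturality (σ : (Φ.F i).obj (𝟙 i) ≅ (Ψ.F i).obj (𝟙 i)) {j : AdjObj}
    {t t' : (reprModule i).X j} (θ : t ⟶ t') : (Φ.F j).map θ ≫ (isoOfBaseApp σ t').hom =
      (isoOfBaseApp σ t).hom ≫ (Ψ.F j).map θ := by
  obtain ⟨t, rfl⟩ := exists_real t
  obtain ⟨t', rfl⟩ := exists_real t'
  rw [isoOfBaseApp_real, isoOfBaseApp_real]
  exact square_comp _ _ (Φ.evIso_naturality σ θ)
    (Ψ.evIso_naturality (_root_.CategoryTheory.Iso.refl _) θ)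

theorem comp_trans_inv_comp {D : Type u} [Category.{v} D] {E : Type u₁} [Category.{v₁} E]
    (G : D ⥤ E) {x y : E} {p q r : D} (f : x ⟶ G.obj p) (g : p ⟶ q) (α : y ≅ G.obj r)
    (β : r ≅ q) : (f ≫ G.map g) ≫ (α ≪≫ G.mapIso β).inv ≫ α.hom = f ≫ G.map (g ≫ β.inv) := by
  simp

/-- Morphisms out of `adj(i, -)` are isomorphic if their values at the identity are. -/
noncomputable def isoOfBase (σ : (Φ.F i).obj (𝟙 i) ≅ (Ψ.F i).obj (𝟙 i)) : Iso Φ Ψ where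
  app j := NatIso.ofComponents (fun t => isoOfBaseApp σ t) (isoOfBaseApp_naturality σ)
  comm {j k} e t := by
    obtain ⟨t, rfl⟩ := exists_real t
    refine (congrArg (· ≫ _) (isoOfBaseApp_real σ (t.cons e))).trans ?_
    refine .trans ?_ (congrArg (fun z => _ ≫ (N.act e).map z) (isoOfBaseApp_real σ t).symm)
    exact (Category.assoc _ _ _).trans (comp_trans_inv_comp (N.act e) _ _ _ _)

theorem isoOfBase_one (σ : (Φ.F i).obj (𝟙 i) ≅ (Ψ.F i).obj (𝟙 i)) :
    ((isoOfBase σ).app i).hom.app (𝟙 i) = σ.hom :=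
  (isoOfBaseApp_real σ .nil).trans (Category.comp_id _)

end Hom

end AdjModule


/-! ## Composition of morphisms of modules -/

section

variable {C : Type u} [Bicategory.{w, v} C] {o : AdjObj → C} {f : o zero ⟶ o one}
  {fv : o one ⟶ o zero} (A : Bicategory.Adjunction fv f)

/-- The composition of morphisms of modules. -/
def AdjModule.Hom.comp {M : AdjModule.{v, u}} {N : AdjModule.{v₁, u₁}} {K : AdjModule.{w₁, w}}
    (Φ : Hom M N) (Ψ : Hom N K) : Hom M K where
  F j := Φ.F j ⋙ Ψ.F j
  iso {j k} e := NatIso.ofComponents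
    (fun x => (Ψ.F k).mapIso ((Φ.iso e).app x) ≪≫ (Ψ.iso e).app ((Φ.F j).obj x)) (fun g => by
      have h := (Φ.iso e).hom.naturality g
      have h' := (Ψ.iso e).hom.naturality ((Φ.F j).map g)
      simp only [Functor.comp_map] at h h'
      have h2 := congrArg (Ψ.F k).map h
      simp only [Functor.map_comp] at h2
      simp [← h', reassoc_of% h2])
  unit x := by
    show (Ψ.F one).map ((Φ.F one).map (M.adj.unit.app x)) ≫
      ((Ψ.F one).map ((Φ.iso .F).hom.app ((M.act .V).obj x)) ≫ (Ψ.iso .F).hom.app _) ≫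
        (K.act .F).map ((Ψ.F zero).map ((Φ.iso .V).hom.app x) ≫ (Ψ.iso .V).hom.app _) =
      K.adj.unit.app ((Ψ.F one).obj ((Φ.F one).obj x))
    have h := (Ψ.iso .F).hom.naturality ((Φ.iso .V).hom.app x)
    have h' := congrArg (Ψ.F one).map (Φ.unit x)
    simp only [Functor.comp_map, Functor.map_comp] at h h'
    rw [← Ψ.unit, ← h']
    simp [reassoc_of% h]
  counit x := by
    have h := (Ψ.iso .V).hom.naturality ((Φ.iso .F).hom.app x)
    simp only [Functor.comp_map] at h
    simp [Φ.counit, Ψ.counit, reassoc_of% h]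

theorem whiskerLeft_unit {x y : C} (g : x ⟶ y) (h : y ⟶ o one) :
    g ◁ ((ρ_ h).inv ≫ h ◁ A.unit ≫ (α_ h fv f).inv) ≫ (α_ g (h ≫ fv) f).inv ≫
      (α_ g h fv).inv ▷ f = (ρ_ (g ≫ h)).inv ≫ (g ≫ h) ◁ A.unit ≫ (α_ (g ≫ h) fv f).inv := by
  bicategory

theorem whiskerLeft_counit {x y : C} (g : x ⟶ y) (h : y ⟶ o zero) :
    g ◁ ((α_ h f fv).hom ≫ h ◁ A.counit ≫ (ρ_ h).hom) = (α_ g (h ≫ f) fv).inv ≫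
      (α_ g h f).inv ▷ fv ≫ (α_ (g ≫ h) f fv).hom ≫ (g ≫ h) ◁ A.counit ≫ (ρ_ (g ≫ h)).hom := by
  bicategory

/-- Composition with a 1-morphism on the left is a morphism of modules. -/
def AdjModule.Hom.precomp {x y : C} (g : x ⟶ y) :
    Hom (ofAdjunction A y) (ofAdjunction A x) where
  F j := Bicategory.precomp (o j) g
  iso e := NatIso.ofComponents (fun h => (α_ g h (e.val f fv)).symm) (fun η => by
    exact (associator_inv_naturality_middle _ _ _))
  unit h := whiskerLeft_unit A g h
  counit h := whiskerLeft_counit A g h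

/-- The data of a pseudofunctor from `adj` in terms of the generators. -/
structure Extension where
  map : ∀ {i j : AdjObj}, (i ⟶ j) → (o i ⟶ o j)
  map₂ : ∀ {i j : AdjObj} {t t' : i ⟶ j}, (t ⟶ t') → (map t ⟶ map t')
  map₂_id : ∀ {i j : AdjObj} (t : i ⟶ j), map₂ (𝟙 t) = 𝟙 (map t)
  map₂_comp : ∀ {i j : AdjObj} {t t' t'' : i ⟶ j} (η : t ⟶ t') (θ : t' ⟶ t''),
    map₂ (η ≫ θ) = map₂ η ≫ map₂ θ
  unitIso : ∀ i, map (𝟙 i) ≅ 𝟙 (o i)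
  step : ∀ {i j k : AdjObj} (t : i ⟶ j) (e : Gen j k), map (t ≫ e.cell) ≅ map t ≫ e.val f fv
  step_naturality : ∀ {i j k : AdjObj} {t t' : i ⟶ j} (η : t ⟶ t') (e : Gen j k),
    map₂ (η ▷ e.cell) ≫ (step t' e).hom = (step t e).hom ≫ map₂ η ▷ e.val f fv
  unit : ∀ {i : AdjObj} (t : i ⟶ one), map₂ ((ρ_ t).inv ≫ t ◁ univ.av ≫ (α_ t univ.fv univ.f).inv) ≫
    (step (t ≫ univ.fv) .F).hom ≫ (step t .V).hom ▷ f =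
      (ρ_ (map t)).inv ≫ map t ◁ A.unit ≫ (α_ (map t) fv f).inv
  counit : ∀ {i : AdjObj} (t : i ⟶ zero),
    map₂ ((α_ t univ.f univ.fv).hom ≫ t ◁ univ.a ≫ (ρ_ t).hom) =
      (step (t ≫ univ.f) .V).hom ≫ (step t .F).hom ▷ fv ≫ (α_ (map t) f fv).hom ≫
        map t ◁ A.counit ≫ (ρ_ (map t)).hom
  mu : ∀ {i j k : AdjObj} (t : i ⟶ j) (t' : j ⟶ k), map (t ≫ t') ≅ map t ≫ map t'
  mu_naturality : ∀ {i j k : AdjObj} (t : i ⟶ j) {t' t'' : j ⟶ k} (η : t' ⟶ t''),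
    map₂ (t ◁ η) ≫ (mu t t'').hom = (mu t t').hom ≫ map t ◁ map₂ η
  mu_one : ∀ {i j : AdjObj} (t : i ⟶ j),
    (mu t (𝟙 j)).hom = map₂ (ρ_ t).hom ≫ (ρ_ (map t)).inv ≫ map t ◁ (unitIso j).inv
  mu_step : ∀ {i j k l : AdjObj} (t : i ⟶ j) (t' : j ⟶ k) (e : Gen k l),
    (mu t (t' ≫ e.cell)).hom ≫ map t ◁ (step t' e).hom ≫ (α_ (map t) (map t') (e.val f fv)).inv =
      map₂ (α_ t t' e.cell).inv ≫ (step (t ≫ t') e).hom ≫ (mu t t').hom ▷ e.val f fv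

namespace Extension

variable {A} (Φ : ∀ i, AdjModule.Hom (reprModule i) (AdjModule.ofAdjunction A (o i)))

/-- The value of a family of morphisms of modules at a 1-morphism. -/
def obj {i j : AdjObj} (t : i ⟶ j) : o i ⟶ o j := ((Φ i).F j).obj t

variable (β : ∀ i, obj Φ (𝟙 i) ≅ 𝟙 (o i))

/-- The comparison of the two ways to map a composition, at the identity. -/
def muOne {i j : AdjObj} (t : i ⟶ j) : obj Φ (t ≫ 𝟙 j) ≅ obj Φ t ≫ obj Φ (𝟙 j) :=
  ((Φ i).F j).mapIso (ρ_ t) ≪≫ (ρ_ (obj Φ t)).symm ≪≫ whiskerLeftIso (obj Φ t) (β j).symm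

/-- The comparison of the two ways to map a composition. -/
noncomputable def muIso {i j : AdjObj} (t : i ⟶ j) :
    AdjModule.Hom.Iso ((AdjModule.Hom.precomp (o := fun j => j) univAdj t).comp (Φ i))
      ((Φ j).comp (AdjModule.Hom.precomp A (obj Φ t))) :=
  AdjModule.Hom.isoOfBase (muOne Φ β t)

/-- A family of morphisms of modules defines an extension. -/
noncomputable def ofHom : Extension A where
  map t := obj Φ t
  map₂ {i j t t'} η := ((Φ i).F j).map η
  map₂_id {i j} t := ((Φ i).F j).map_id t
  map₂_comp {i j t t' t''} η θ := ((Φ i).F j).map_comp η θ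
  unitIso i := β i
  step {i j k} t e := ((Φ i).iso e).app t
  step_naturality {i j k t t'} η e := ((Φ i).iso e).hom.naturality η
  unit {i} t := (Φ i).unit t
  counit {i} t := (Φ i).counit t
  mu {i j k} t t' := ((muIso Φ β t).app k).app t'
  mu_naturality {i j k} t {t' t''} η := ((muIso Φ β t).app k).hom.naturality η
  mu_one t := AdjModule.Hom.isoOfBase_one
    (Φ := (AdjModule.Hom.precomp (o := fun j => j) univAdj t).comp (Φ _))
    (Ψ := (Φ _).comp (AdjModule.Hom.precomp A (obj Φ t))) (muOne Φ β t)
  mu_step {i j k l} t t' e := by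
    have h := (muIso Φ β t).comm e t'
    exact h.trans (Category.assoc _ _ _)
variable (A) in
/-- Every adjoint pair defines an extension. -/
theorem nonempty : Nonempty (Extension A) :=
  ⟨ofHom (fun i => AdjModule.Hom.ofPoint (AdjModule.ofAdjunction A (o i)) (𝟙 (o i)))
    fun i => AdjModule.Hom.ofPointIso (AdjModule.ofAdjunction A (o i)) (𝟙 (o i))⟩

end Extension

end


/-! ## The pseudofunctor defined by an adjoint pair -/

namespace Extension

variable {C : Type u} [Bicategory.{w, v} C] {o : AdjObj → C} {f : o zero ⟶ o one}
  {fv : o one ⟶ o zero} {A : Bicategory.Adjunction fv f} (E : Extension A)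

theorem map₂_hom_inv {i j : AdjObj} {t t' : i ⟶ j} (κ : t ≅ t') :
    E.map₂ κ.hom ≫ E.map₂ κ.inv = 𝟙 _ := by
  rw [← map₂_comp, κ.hom_inv_id, map₂_id]

theorem map₂_inv_hom {i j : AdjObj} {t t' : i ⟶ j} (κ : t ≅ t') :
    E.map₂ κ.inv ≫ E.map₂ κ.hom = 𝟙 _ := by
  rw [← map₂_comp, κ.inv_hom_id, map₂_id]

/-- Naturality in the second variable is part of the construction of `mu`; in the first it needs
induction on `r`, with `mu_one` as the base and `mu_step` for an added generator. The associator and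
the left unitor are treated in the same way. -/
theorem mu_naturality_left {i j k : AdjObj} {t t' : i ⟶ j} (η : t ⟶ t') (r : j ⟶ k) :
    E.map₂ (η ▷ r) ≫ (E.mu t' r).hom = (E.mu t r).hom ≫ E.map₂ η ▷ E.map r := by
  refine oneCell_induction (P := fun k r =>
    E.map₂ (η ▷ r) ≫ (E.mu t' r).hom = (E.mu t r).hom ≫ E.map₂ η ▷ E.map r) ?_ ?_ r
  · rw [mu_one, mu_one, ← reassoc_of% E.map₂_comp, rightUnitor_naturality, reassoc_of% E.map₂_comp]
    simp only [Category.assoc, whisker_exchange]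
    rw [rightUnitor_inv_naturality_assoc]
  · intro k l r e ih
    rw [← cancel_mono (E.map t' ◁ (E.step r e).hom ≫ (α_ _ _ _).inv), Category.assoc,
      Category.assoc, mu_step, ← reassoc_of% E.map₂_comp, associator_inv_naturality_left,
      reassoc_of% E.map₂_comp, reassoc_of% E.step_naturality, ← comp_whiskerRight, ih, comp_whiskerRight,
      ← whisker_exchange_assoc, associator_inv_naturality_left, reassoc_of% E.mu_step]

theorem mu_associator {i j k l : AdjObj} (t : i ⟶ j) (t' : j ⟶ k) (r : k ⟶ l) :
    E.map₂ (α_ t t' r).hom ≫ (E.mu t (t' ≫ r)).hom ≫ E.map t ◁ (E.mu t' r).hom =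
      (E.mu (t ≫ t') r).hom ≫ (E.mu t t').hom ▷ E.map r ≫ (α_ _ _ _).hom := by
  refine oneCell_induction (P := fun l r =>
    E.map₂ (α_ t t' r).hom ≫ (E.mu t (t' ≫ r)).hom ≫ E.map t ◁ (E.mu t' r).hom =
      (E.mu (t ≫ t') r).hom ≫ (E.mu t t').hom ▷ E.map r ≫ (α_ _ _ _).hom) ?_ ?_ r
  · rw [mu_one, mu_one]
    simp only [whiskerLeft_comp, Category.assoc]
    rw [← reassoc_of% E.mu_naturality, ← reassoc_of% E.map₂_comp, ← rightUnitor_comp]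
    rw [whisker_exchange_assoc, ← rightUnitor_inv_naturality_assoc]
    simp
  · intro k l r e ih
    rw [← cancel_mono (E.map t ◁ E.map t' ◁ (E.step r e).hom ≫ E.map t ◁ (α_ _ _ _).inv ≫
      (α_ _ _ _).inv)]
    -- `h1` moves the generator `e` out of both constraints, and `h2` and `h3` are the pentagons in
    -- `adj` and in `C`; the induction hypothesis then applies whiskered by `e`.
    have h1 : (E.mu t (t' ≫ r ≫ e.cell)).hom ≫ E.map t ◁ (E.mu t' (r ≫ e.cell)).hom ≫
        E.map t ◁ E.map t' ◁ (E.step r e).hom ≫ E.map t ◁ (α_ _ _ _).inv ≫ (α_ _ _ _).inv =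
          E.map₂ (t ◁ (α_ t' r e.cell).inv ≫ (α_ t (t' ≫ r) e.cell).inv) ≫
            (E.step (t ≫ t' ≫ r) e).hom ≫
              ((E.mu t (t' ≫ r)).hom ≫ E.map t ◁ (E.mu t' r).hom) ▷ e.val f fv := by
      rw [← whiskerLeft_comp_assoc, ← whiskerLeft_comp_assoc, Category.assoc, E.mu_step]
      simp only [whiskerLeft_comp, Category.assoc]
      rw [← reassoc_of% E.mu_naturality, associator_inv_naturality_middle, reassoc_of% E.mu_step,
        reassoc_of% E.map₂_comp, comp_whiskerRight]
    have h2 : (α_ t t' (r ≫ e.cell)).hom ≫ t ◁ (α_ t' r e.cell).inv ≫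
        (α_ t (t' ≫ r) e.cell).inv = (α_ (t ≫ t') r e.cell).inv ≫ (α_ t t' r).hom ▷ e.cell := by
      simp
    have h3 : (α_ (E.map t) (E.map t') (E.map r ≫ e.val f fv)).hom ≫
        E.map t ◁ (α_ (E.map t') (E.map r) (e.val f fv)).inv ≫ (α_ _ _ _).inv =
          (α_ _ _ _).inv ≫ (α_ (E.map t) (E.map t') (E.map r)).hom ▷ e.val f fv := by
      simp
    simp only [Category.assoc]
    rw [h1, ← reassoc_of% E.map₂_comp, h2, reassoc_of% E.map₂_comp, reassoc_of% E.step_naturality, ← comp_whiskerRight,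
      ih, ← associator_naturality_right_assoc, h3, ← whisker_exchange_assoc,
      associator_inv_naturality_left_assoc, reassoc_of% E.mu_step]
    simp only [comp_whiskerRight]

theorem mu_left_unitor {i j : AdjObj} (r : i ⟶ j) :
    E.map₂ (λ_ r).hom = (E.mu (𝟙 i) r).hom ≫ (E.unitIso i).hom ▷ E.map r ≫ (λ_ _).hom := by
  refine oneCell_induction (P := fun j r =>
    E.map₂ (λ_ r).hom = (E.mu (𝟙 i) r).hom ≫ (E.unitIso i).hom ▷ E.map r ≫ (λ_ _).hom) ?_ ?_ r
  · rw [mu_one]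
    simp only [Category.assoc, whisker_exchange_assoc]
    simp [unitors_equal]
  · intro k l r e ih
    have h := E.mu_step (𝟙 i) r e
    have h1 : E.map₂ (λ_ (r ≫ e.cell)).hom ≫ (E.step r e).hom = E.map₂ (α_ (𝟙 i) r e.cell).inv ≫
        (E.step (𝟙 i ≫ r) e).hom ≫ E.map₂ (λ_ r).hom ▷ e.val f fv := by
      rw [← step_naturality, ← reassoc_of% E.map₂_comp, ← leftUnitor_comp]
    rw [← cancel_mono (E.step r e).hom, h1, ih, comp_whiskerRight, reassoc_of% h.symm]
    simp only [Category.assoc, comp_whiskerRight, ← associator_inv_naturality_left_assoc,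
      whisker_exchange_assoc, ← leftUnitor_naturality]
    simp

theorem mu_right_unitor {i j : AdjObj} (t : i ⟶ j) :
    E.map₂ (ρ_ t).hom = (E.mu t (𝟙 j)).hom ≫ E.map t ◁ (E.unitIso j).hom ≫ (ρ_ _).hom := by
  rw [mu_one]
  simp

/-- The pseudofunctor defined by an extension. -/
def toPseudofunctorOn : PseudofunctorOn o where
  map t := E.map t
  map₂ η := E.map₂ η
  map₂_id t := E.map₂_id t
  map₂_comp η θ := E.map₂_comp η θ
  mapId i := E.unitIso i
  mapComp t r := E.mu t r
  map₂_whisker_left t _ _ η := by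
    rw [← Category.assoc, Iso.eq_comp_inv, E.mu_naturality]
  map₂_whisker_right η r := by
    rw [← Category.assoc, Iso.eq_comp_inv, E.mu_naturality_left]
  map₂_associator t t' r := by
    have h := E.mu_associator t t' r
    rw [← cancel_mono ((E.mu t (t' ≫ r)).hom ≫ E.map t ◁ (E.mu t' r).hom), h]
    simp
  map₂_left_unitor t := E.mu_left_unitor t
  map₂_right_unitor t := E.mu_right_unitor t

/-- The value of an extension at a generator. -/
@[simps]
def genIso {j k : AdjObj} (e : Gen j k) : E.map e.cell ≅ e.val f fv where
  hom := E.map₂ (λ_ e.cell).inv ≫ (E.step (𝟙 j) e).hom ≫ (E.unitIso j).hom ▷ e.val f fv ≫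
    (λ_ _).hom
  inv := (λ_ _).inv ≫ (E.unitIso j).inv ▷ e.val f fv ≫ (E.step (𝟙 j) e).inv ≫
    E.map₂ (λ_ e.cell).hom
  hom_inv_id := by
    simp [map₂_inv_hom]
  inv_hom_id := by
    simp [reassoc_of% E.map₂_hom_inv]

/-- This is `mu_step` at an identity, simplified by the triangle axiom. It translates the module
structure into the constraint `mu`, in terms of which the image of a quadruple is defined. -/
theorem step_eq {i j k : AdjObj} (t : i ⟶ j) (e : Gen j k) :
    (E.step t e).hom = (E.mu t e.cell).hom ≫ E.map t ◁ (E.genIso e).hom := by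
  have h := E.mu_step t (𝟙 j) e
  rw [mu_one, comp_whiskerRight, ← reassoc_of% E.step_naturality, ← reassoc_of% E.map₂_comp,
    triangle_assoc_comp_right] at h
  have h' := congrArg (E.map₂ (t ◁ (λ_ e.cell).inv) ≫ ·) h
  simp only [← reassoc_of% E.map₂_comp, ← whiskerLeft_comp, Iso.inv_hom_id] at h'
  rw [whiskerLeft_id, map₂_id, Category.id_comp, reassoc_of% E.mu_naturality] at h'
  rw [genIso_hom, whiskerLeft_comp, whiskerLeft_comp]
  rw [← cancel_mono ((ρ_ (E.map t)).inv ▷ e.val f fv ≫ (E.map t ◁ (E.unitIso j).inv) ▷ e.val f fv),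
    ← comp_whiskerRight, ← h']
  simp

/-- The isomorphism `genIso` for `f`. -/
def isoF : E.map univ.f ≅ f := E.genIso .F

/-- The isomorphism `genIso` for `f^∨`. -/
def isoV : E.map univ.fv ≅ fv := E.genIso .V

/-- The isomorphism `step` for `f`. -/
def stepF {i : AdjObj} (t : i ⟶ zero) : E.map (t ≫ univ.f) ≅ E.map t ≫ f := E.step t .F

/-- The isomorphism `step` for `f^∨`. -/
def stepV {i : AdjObj} (t : i ⟶ one) : E.map (t ≫ univ.fv) ≅ E.map t ≫ fv := E.step t .V

theorem isoF_hom : E.isoF.hom = E.map₂ (λ_ univ.f).inv ≫ (E.stepF (𝟙 zero)).hom ≫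
    (E.unitIso zero).hom ▷ f ≫ (λ_ f).hom := rfl

theorem isoV_hom : E.isoV.hom = E.map₂ (λ_ univ.fv).inv ≫ (E.stepV (𝟙 one)).hom ≫
    (E.unitIso one).hom ▷ fv ≫ (λ_ fv).hom := rfl

theorem stepV_naturality {i : AdjObj} {t t' : i ⟶ one} (η : t ⟶ t') :
    E.map₂ (η ▷ univ.fv) ≫ (E.stepV t').hom = (E.stepV t).hom ≫ E.map₂ η ▷ fv :=
  E.step_naturality η .V

theorem stepF_naturality {i : AdjObj} {t t' : i ⟶ zero} (η : t ⟶ t') :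
    E.map₂ (η ▷ univ.f) ≫ (E.stepF t').hom = (E.stepF t).hom ≫ E.map₂ η ▷ f :=
  E.step_naturality η .F

theorem stepV_eq : (E.stepV univ.f).hom = (E.mu univ.f univ.fv).hom ≫
    E.map univ.f ◁ E.isoV.hom := E.step_eq univ.f .V

theorem stepF_eq : (E.stepF univ.fv).hom = (E.mu univ.fv univ.f).hom ≫
    E.map univ.fv ◁ E.isoF.hom := E.step_eq univ.fv .F

/-- The module condition on counits is evaluated at the identity of `0`, and the extra unitors are
then cancelled. `map₂_unit` does the same for the unit at the identity of `1`. -/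
theorem map₂_counit : E.map₂ univ.a ≫ (E.unitIso zero).hom =
    (E.mu univ.f univ.fv).hom ≫ E.isoF.hom ▷ E.map univ.fv ≫ f ◁ E.isoV.hom ≫ A.counit := by
  have h : E.map₂ ((α_ (𝟙 zero) univ.f univ.fv).hom ≫ 𝟙 zero ◁ univ.a ≫ (ρ_ (𝟙 zero)).hom) =
      (E.stepV (𝟙 zero ≫ univ.f)).hom ≫ (E.stepF (𝟙 zero)).hom ▷ fv ≫
        (α_ (E.map (𝟙 zero)) f fv).hom ≫ E.map (𝟙 zero) ◁ A.counit ≫ (ρ_ _).hom :=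
    E.counit (𝟙 zero)
  have h1 : (α_ (𝟙 zero) univ.f univ.fv).hom ≫ 𝟙 zero ◁ univ.a ≫ (ρ_ (𝟙 zero)).hom =
      (λ_ univ.f).hom ▷ univ.fv ≫ univ.a := by
    rw [← unitors_equal, leftUnitor_naturality]
    simp
  have h2 : univ.a = (λ_ univ.f).inv ▷ univ.fv ≫ (λ_ univ.f).hom ▷ univ.fv ≫ univ.a := by
    simp
  have h5 : (α_ (E.map (𝟙 zero)) f fv).hom ≫ E.map (𝟙 zero) ◁ A.counit ≫ (ρ_ _).hom ≫
      (E.unitIso zero).hom = (E.unitIso zero).hom ▷ f ▷ fv ≫ (λ_ f).hom ▷ fv ≫ A.counit := by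
    rw [← rightUnitor_naturality, whisker_exchange_assoc, ← unitors_equal, leftUnitor_naturality]
    simp
  rw [h2, map₂_comp, ← h1, h]
  simp only [Category.assoc]
  rw [reassoc_of% E.stepV_naturality, stepV_eq]
  simp only [Category.assoc]
  rw [h5, ← whisker_exchange_assoc, isoF_hom]
  simp only [comp_whiskerRight, Category.assoc]

theorem map₂_unit : (E.unitIso one).inv ≫ E.map₂ univ.av ≫ (E.mu univ.fv univ.f).hom ≫
    E.isoV.hom ▷ E.map univ.f ≫ fv ◁ E.isoF.hom = A.unit := by
  have h : E.map₂ ((ρ_ (𝟙 one)).inv ≫ 𝟙 one ◁ univ.av ≫ (α_ (𝟙 one) univ.fv univ.f).inv) ≫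
      (E.stepF (𝟙 one ≫ univ.fv)).hom ≫ (E.stepV (𝟙 one)).hom ▷ f =
        (ρ_ _).inv ≫ E.map (𝟙 one) ◁ A.unit ≫ (α_ _ fv f).inv := E.unit (𝟙 one)
  have h1 : (ρ_ (𝟙 one)).inv ≫ 𝟙 one ◁ univ.av ≫ (α_ (𝟙 one) univ.fv univ.f).inv =
      univ.av ≫ (λ_ univ.fv).inv ▷ univ.f := by
    rw [← unitors_inv_equal, ← leftUnitor_inv_naturality_assoc]
    simp
  rw [h1, map₂_comp, Category.assoc, reassoc_of% E.stepF_naturality, stepF_eq, Category.assoc] at h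
  have h5 := congrArg (fun z => (E.unitIso one).inv ≫ z ≫
    (E.unitIso one).hom ▷ fv ▷ f ≫ (λ_ fv).hom ▷ f) h
  have h6 : (E.unitIso one).inv ≫ ((ρ_ (E.map (𝟙 one))).inv ≫ E.map (𝟙 one) ◁ A.unit ≫
      (α_ (E.map (𝟙 one)) fv f).inv) ≫ (E.unitIso one).hom ▷ fv ▷ f ≫ (λ_ fv).hom ▷ f =
        A.unit := by
    simp only [Category.assoc, ← associator_inv_naturality_left_assoc, whisker_exchange_assoc]
    rw [← rightUnitor_inv_naturality_assoc, Iso.inv_hom_id_assoc, ← unitors_inv_equal,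
      ← leftUnitor_inv_naturality_assoc]
    simp
  refine .trans ?_ (h5.trans h6)
  rw [← whisker_exchange, isoV_hom]
  simp only [comp_whiskerRight, Category.assoc]

/-- The image of the universal quadruple under the pseudofunctor defined by an extension. -/
def imageIso : AdjQuadruple.Iso (E.toPseudofunctorOn.image univ)
    ⟨f, fv, A.counit, A.unit⟩ where
  isoF := E.isoF
  isoFv := E.isoV
  a_comm := by
    show _ = (E.mu univ.f univ.fv).inv ≫ E.map₂ univ.a ≫ (E.unitIso zero).hom
    rw [map₂_counit, Iso.inv_hom_id_assoc]
    rfl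
  av_comm := by
    refine .trans ?_ E.map₂_unit
    simp only [PseudofunctorOn.image, toPseudofunctorOn, Category.assoc]

end Extension


/-! ## Uniqueness of the pseudofunctor defined by an adjoint pair -/

namespace Uniqueness

variable {C : Type u} [Bicategory.{w, v} C] {o : AdjObj → C} {f : o zero ⟶ o one}
  {fv : o one ⟶ o zero} {A : Bicategory.Adjunction fv f} {S T : PseudofunctorOn o}
  (φ : AdjQuadruple.Iso (S.image univ) ⟨f, fv, A.counit, A.unit⟩)
  (ψ : AdjQuadruple.Iso (T.image univ) ⟨f, fv, A.counit, A.unit⟩)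

/-- The isomorphism of quadruples, at a generator. -/
def genIso : {j k : AdjObj} → (e : Gen j k) → (S.map e.cell ≅ e.val f fv)
  | _, _, .V => φ.isoFv
  | _, _, .F => φ.isoF

/-- The compatibility of a pseudofunctor with the action of the generators. -/
def step {i j k : AdjObj} (t : i ⟶ j) (e : Gen j k) :
    S.map (t ≫ e.cell) ≅ S.map t ≫ e.val f fv :=
  S.mapComp t e.cell ≪≫ whiskerLeftIso (S.map t) (genIso φ e)

theorem map₂_whiskerRight_comp {i j k : AdjObj} {t t' : i ⟶ j} (η : t ⟶ t') (r : j ⟶ k) :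
    S.map₂ (η ▷ r) ≫ (S.mapComp t' r).hom = (S.mapComp t r).hom ≫ S.map₂ η ▷ S.map r := by
  simp [S.map₂_whisker_right]

theorem map₂_whiskerLeft_comp {i j k : AdjObj} (t : i ⟶ j) {r r' : j ⟶ k} (η : r ⟶ r') :
    S.map₂ (t ◁ η) ≫ (S.mapComp t r').hom = (S.mapComp t r).hom ≫ S.map t ◁ S.map₂ η := by
  simp [S.map₂_whisker_left]

theorem map₂_associator_comp {i j k l : AdjObj} (t : i ⟶ j) (t' : j ⟶ k) (r : k ⟶ l) :
    S.map₂ (α_ t t' r).hom ≫ (S.mapComp t (t' ≫ r)).hom ≫ S.map t ◁ (S.mapComp t' r).hom =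
      (S.mapComp (t ≫ t') r).hom ≫ (S.mapComp t t').hom ▷ S.map r ≫ (α_ _ _ _).hom := by
  simp [S.map₂_associator]

theorem map₂_associator_inv_comp {i j k l : AdjObj} (t : i ⟶ j) (t' : j ⟶ k) (r : k ⟶ l) :
    S.map₂ (α_ t t' r).inv ≫ (S.mapComp (t ≫ t') r).hom ≫ (S.mapComp t t').hom ▷ S.map r =
      (S.mapComp t (t' ≫ r)).hom ≫ S.map t ◁ (S.mapComp t' r).hom ≫ (α_ _ _ _).inv := by
  have h := S.map₂_comp (α_ t t' r).inv (α_ t t' r).hom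
  rw [Iso.inv_hom_id, S.map₂_id] at h
  have h2 := congrArg (S.map₂ (α_ t t' r).inv ≫ · ≫ (α_ _ _ _).inv) (map₂_associator_comp t t' r)
  simp only [Category.assoc, ← reassoc_of% h, Iso.hom_inv_id, Category.comp_id] at h2
  exact h2.symm

theorem step_naturality {i j k : AdjObj} {t t' : i ⟶ j} (η : t ⟶ t') (e : Gen j k) :
    S.map₂ (η ▷ e.cell) ≫ (step φ t' e).hom = (step φ t e).hom ≫ S.map₂ η ▷ e.val f fv := by
  simp only [step, Iso.trans_hom, whiskerLeftIso_hom, Category.assoc]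
  rw [reassoc_of% map₂_whiskerRight_comp (S := S), ← whisker_exchange]

/-- Conversely to the previous section, compatibility for the single quadruple gives the module
condition at every `t`, because pseudofunctors respect whiskering by `t`. -/
theorem map₂_unit (p : S.map univ.f ≅ f) (q : S.map univ.fv ≅ fv)
    (h : (((S.mapId one).inv ≫ S.map₂ univ.av ≫ (S.mapComp univ.fv univ.f).hom) ≫
      q.hom ▷ S.map univ.f ≫ fv ◁ p.hom) = A.unit) {i : AdjObj} (t : i ⟶ one) :
    S.map₂ ((ρ_ t).inv ≫ t ◁ univ.av ≫ (α_ t univ.fv univ.f).inv) ≫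
      ((S.mapComp (t ≫ univ.fv) univ.f).hom ≫ S.map (t ≫ univ.fv) ◁ p.hom) ≫
        ((S.mapComp t univ.fv).hom ≫ S.map t ◁ q.hom) ▷ f =
          (ρ_ (S.map t)).inv ≫ S.map t ◁ A.unit ≫ (α_ (S.map t) fv f).inv := by
  have h1 : S.map₂ (ρ_ t).inv ≫ (S.mapComp t (𝟙 one)).hom =
      (ρ_ (S.map t)).inv ≫ S.map t ◁ (S.mapId one).inv := by
    have h2 := S.map₂_comp (ρ_ t).inv (ρ_ t).hom
    rw [Iso.inv_hom_id, S.map₂_id, S.map₂_right_unitor] at h2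
    rw [← cancel_mono (S.map t ◁ (S.mapId one).hom ≫ (ρ_ (S.map t)).hom)]
    simp only [Category.assoc, ← h2]
    simp
  rw [S.map₂_comp, S.map₂_comp, comp_whiskerRight]
  simp only [Category.assoc]
  rw [whisker_exchange_assoc, reassoc_of% map₂_associator_inv_comp (S := S), reassoc_of% map₂_whiskerLeft_comp (S := S),
    reassoc_of% h1, ← associator_inv_naturality_right_assoc, ← associator_inv_naturality_middle,
    ← h, ← whisker_exchange]
  simp only [whiskerLeft_comp, Category.assoc]

theorem map₂_counit (p : S.map univ.f ≅ f) (q : S.map univ.fv ≅ fv)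
    (h : p.hom ▷ S.map univ.fv ≫ f ◁ q.hom ≫ A.counit =
      (S.mapComp univ.f univ.fv).inv ≫ S.map₂ univ.a ≫ (S.mapId zero).hom)
    {i : AdjObj} (t : i ⟶ zero) :
    S.map₂ ((α_ t univ.f univ.fv).hom ≫ t ◁ univ.a ≫ (ρ_ t).hom) =
      ((S.mapComp (t ≫ univ.f) univ.fv).hom ≫ S.map (t ≫ univ.f) ◁ q.hom) ≫
        ((S.mapComp t univ.f).hom ≫ S.map t ◁ p.hom) ▷ fv ≫ (α_ (S.map t) f fv).hom ≫
          S.map t ◁ A.counit ≫ (ρ_ (S.map t)).hom := by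
  simp only [comp_whiskerRight, Category.assoc]
  rw [whisker_exchange_assoc, associator_naturality_middle_assoc,
    associator_naturality_right_assoc, ← reassoc_of% map₂_associator_comp (S := S)]
  simp only [← whiskerLeft_comp_assoc]
  rw [whisker_exchange_assoc, h, Iso.hom_inv_id_assoc, whiskerLeft_comp_assoc,
    ← reassoc_of% map₂_whiskerLeft_comp (S := S), ← S.map₂_right_unitor, S.map₂_comp, S.map₂_comp]

/-- The morphism of modules defined by a pseudofunctor. -/
def toHom (i : AdjObj) : AdjModule.Hom (reprModule i) (AdjModule.ofAdjunction A (o i)) where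
  F _ :=
    { obj := fun t => S.map t
      map := fun η => S.map₂ η
      map_id := fun t => S.map₂_id t
      map_comp := fun η θ => S.map₂_comp η θ }
  iso e := NatIso.ofComponents (fun t => step φ t e) (fun η => step_naturality φ η e)
  unit t := map₂_unit φ.isoF φ.isoFv φ.av_comm t
  counit t := map₂_counit φ.isoF φ.isoFv φ.a_comm t

/-- The comparison of two pseudofunctors. -/
noncomputable def homIso (i : AdjObj) : AdjModule.Hom.Iso (toHom φ i) (toHom ψ i) :=
  AdjModule.Hom.isoOfBase (Φ := toHom φ i) (Ψ := toHom ψ i) (S.mapId i ≪≫ (T.mapId i).symm)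

/-- The component at a 1-morphism of the comparison of two pseudofunctors. -/
noncomputable def app {i j : AdjObj} (t : i ⟶ j) : S.map t ≅ T.map t :=
  ((homIso φ ψ i).app j).app t

theorem app_naturality {i j : AdjObj} {t t' : i ⟶ j} (η : t ⟶ t') :
    S.map₂ η ≫ (app φ ψ t').hom = (app φ ψ t).hom ≫ T.map₂ η :=
  ((homIso φ ψ i).app j).hom.naturality η

theorem app_one (i : AdjObj) :
    (app φ ψ (𝟙 i)).hom = (S.mapId i).hom ≫ (T.mapId i).inv :=
  AdjModule.Hom.isoOfBase_one (Φ := toHom φ i) (Ψ := toHom ψ i) (S.mapId i ≪≫ (T.mapId i).symm)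

theorem app_step {i j k : AdjObj} (t : i ⟶ j) (e : Gen j k) :
    (app φ ψ (t ≫ e.cell)).hom ≫ (step ψ t e).hom =
      (step φ t e).hom ≫ (app φ ψ t).hom ▷ e.val f fv :=
  (homIso φ ψ i).comm e t

/-- The comparison is normalized only at identities; writing a generator as `𝟙 j ≫ e.cell` transfers
this to the generator by way of `app_step` and the left unitors. -/
theorem app_gen {j k : AdjObj} (e : Gen j k) :
    (app φ ψ e.cell).hom ≫ (genIso ψ e).hom = (genIso φ e).hom := by
  have h := app_step φ ψ (𝟙 j) e
  have h1 := app_naturality φ ψ (λ_ e.cell).hom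
  simp only [step, Iso.trans_hom, whiskerLeftIso_hom, Category.assoc] at h
  rw [S.map₂_left_unitor, T.map₂_left_unitor] at h1
  simp only [Category.assoc] at h1
  rw [← cancel_epi ((S.mapComp (𝟙 j) e.cell).hom ≫ (S.mapId j).hom ▷ S.map e.cell ≫ (λ_ _).hom)]
  simp only [Category.assoc]
  rw [reassoc_of% h1, ← leftUnitor_naturality, ← whisker_exchange_assoc, reassoc_of% h, app_one,
    ← leftUnitor_naturality, ← whisker_exchange_assoc]
  simp

theorem mapComp_step {i j k l : AdjObj} (t : i ⟶ j) (r : j ⟶ k) (e : Gen k l) :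
    (S.mapComp t (r ≫ e.cell)).hom ≫ S.map t ◁ (step φ r e).hom ≫ (α_ _ _ _).inv =
      S.map₂ (α_ t r e.cell).inv ≫ (step φ (t ≫ r) e).hom ≫ (S.mapComp t r).hom ▷ e.val f fv := by
  simp only [step, Iso.trans_hom, whiskerLeftIso_hom, Category.assoc, whiskerLeft_comp]
  rw [whisker_exchange, reassoc_of% map₂_associator_inv_comp (S := S), ← associator_inv_naturality_right]

/-- The comparison respects single generators by construction, and induction on `r` extends this to
all composites. -/
theorem app_comp {i j k : AdjObj} (t : i ⟶ j) (r : j ⟶ k) :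
    (app φ ψ (t ≫ r)).hom ≫ (T.mapComp t r).hom =
      (S.mapComp t r).hom ≫ (app φ ψ t).hom ▷ S.map r ≫ T.map t ◁ (app φ ψ r).hom := by
  refine oneCell_induction (P := fun k r => (app φ ψ (t ≫ r)).hom ≫ (T.mapComp t r).hom =
    (S.mapComp t r).hom ≫ (app φ ψ t).hom ▷ S.map r ≫ T.map t ◁ (app φ ψ r).hom) ?_ ?_ r
  · have h := app_naturality φ ψ (ρ_ t).hom
    rw [S.map₂_right_unitor, T.map₂_right_unitor] at h
    rw [← cancel_mono (T.map t ◁ (T.mapId j).hom ≫ (ρ_ (T.map t)).hom), app_one, Category.assoc,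
      ← h]
    simp [← whisker_exchange_assoc]
  · intro k l r e ih
    have h := app_naturality φ ψ (α_ t r e.cell).inv
    rw [← cancel_mono (T.map t ◁ (step ψ r e).hom ≫ (α_ _ _ _).inv), Category.assoc,
      mapComp_step, ← reassoc_of% h, reassoc_of% app_step φ ψ, ← comp_whiskerRight, ih]
    simp only [Category.assoc, comp_whiskerRight]
    rw [← reassoc_of% mapComp_step φ, ← whiskerLeft_comp_assoc, app_step, whiskerLeft_comp_assoc,
      ← whisker_exchange_assoc, associator_inv_naturality_middle,
      associator_inv_naturality_left_assoc]

/-- The values at identities are forced by `app_id`, and the value at a composite is forced by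
`app_comp`, since the constraints of `T` are invertible. -/
theorem ext {θ θ' : PseudofunctorOn.Iso S T}
    (h : ∀ {j k : AdjObj} (e : Gen j k), (θ.app e.cell).hom = (θ'.app e.cell).hom) : θ = θ' := by
  have key : ∀ (i j : AdjObj) (t : i ⟶ j), (θ.app t).hom = (θ'.app t).hom := by
    intro i j t
    refine oneCell_induction (P := fun j t => (θ.app t).hom = (θ'.app t).hom) ?_ ?_ t
    · rw [← cancel_mono (T.mapId i).hom, θ.app_id, θ'.app_id]
    · intro j k t e ih
      rw [← cancel_mono (T.mapComp t e.cell).hom, θ.app_comp, θ'.app_comp, ih, h]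
  refine PseudofunctorOn.Iso.ext ?_
  funext i j t
  exact CategoryTheory.Iso.ext (key i j t)

/-- The comparison of two pseudofunctors, as an isomorphism of pseudofunctors. -/
noncomputable def iso : PseudofunctorOn.Iso S T where
  app t := app φ ψ t
  naturality η := app_naturality φ ψ η
  app_id i := by rw [app_one, Category.assoc, Iso.inv_hom_id, Category.comp_id]
  app_comp t r := app_comp φ ψ t r

theorem existsUnique : ∃! θ : PseudofunctorOn.Iso S T,
    (θ.app univ.f).hom ≫ ψ.isoF.hom = φ.isoF.hom ∧
      (θ.app univ.fv).hom ≫ ψ.isoFv.hom = φ.isoFv.hom := by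
  refine ⟨iso φ ψ, ⟨app_gen φ ψ .F, app_gen φ ψ .V⟩, ?_⟩
  intro θ hθ
  refine ext fun {j k} e => ?_
  rw [← cancel_mono (genIso ψ e).hom]
  refine .trans ?_ (app_gen φ ψ e).symm
  cases e with
  | V => exact hθ.2
  | F => exact hθ.1

end Uniqueness


/-! ## The hom-categories of `adj` -/

theorem special_of_first {X Y : SimplexCategory} (g : X ⟶ Y)
    (h : ∀ x : Fin (X.len + 1), x.val = 0 → (g.toOrderHom x).val = 0) : special g :=
  Fin.ext (h 0 rfl)

theorem antispecial_of_last {X Y : SimplexCategory} (g : X ⟶ Y)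
    (h : ∀ x : Fin (X.len + 1), x.val + 1 = X.len + 1 → (g.toOrderHom x).val + 1 = Y.len + 1) :
    antispecial g :=
  Fin.ext (Nat.succ.inj (h (Fin.last _) rfl))

/-- The simplex `[n]` has `n + 1` elements, and positivity of the size makes the subtraction exact.
-/
theorem nonempty_ofSimplex_iso {i j : AdjObj} (t : OneCell i j) (h : 0 < t.size) :
    Nonempty (ofSimplex i j (SimplexCategory.mk (t.size - 1)) ≅ t) :=
  ⟨castIso (Nat.sub_add_cancel h)⟩

theorem fromDeltaPM_isEquivalence : fromDeltaPM.IsEquivalence where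
  faithful := ⟨fun h => WideSubcategory.hom_ext _
    (SimplexCategory.Hom.ext _ _ (congrArg TwoCell.toMap h))⟩
  full := ⟨fun θ => ⟨⟨SimplexCategory.Hom.mk (TwoCell.toMap θ),
    special_of_first _ (TwoCell.map_first θ rfl), antispecial_of_last _ (TwoCell.map_last θ rfl)⟩,
    rfl⟩⟩
  essSurj := ⟨fun t => ⟨⟨SimplexCategory.mk (OneCell.size t - 1)⟩,
    nonempty_ofSimplex_iso t (OneCell.pos_left t rfl)⟩⟩

theorem fromDeltaPlus_isEquivalence : fromDeltaPlus.IsEquivalence where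
  faithful := ⟨fun h => WideSubcategory.hom_ext _
    (SimplexCategory.Hom.ext _ _ (congrArg TwoCell.toMap h))⟩
  full := ⟨fun θ => ⟨⟨SimplexCategory.Hom.mk (TwoCell.toMap θ),
    special_of_first _ (TwoCell.map_first θ rfl)⟩, rfl⟩⟩
  essSurj := ⟨fun t => ⟨⟨SimplexCategory.mk (OneCell.size t - 1)⟩,
    nonempty_ofSimplex_iso t (OneCell.pos_left t rfl)⟩⟩

theorem fromDeltaMinus_isEquivalence : fromDeltaMinus.IsEquivalence where
  faithful := ⟨fun h => WideSubcategory.hom_ext _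
    (SimplexCategory.Hom.ext _ _ (congrArg TwoCell.toMap h))⟩
  full := ⟨fun θ => ⟨⟨SimplexCategory.Hom.mk (TwoCell.toMap θ),
    antispecial_of_last _ (TwoCell.map_last θ rfl)⟩, rfl⟩⟩
  essSurj := ⟨fun t => ⟨⟨SimplexCategory.mk (OneCell.size t - 1)⟩,
    nonempty_ofSimplex_iso t (OneCell.pos_right t rfl)⟩⟩

theorem fromDeltaAug_isEquivalence : fromDeltaAug.IsEquivalence where
  faithful := ⟨fun {X Y} g g' h => by
    match X, Y, g, g', h with
    | WithInitial.star, _, _, _, _ => exact Subsingleton.elim _ _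
    | WithInitial.of _, WithInitial.star, g, _, _ => exact (WithInitial.false_of_to_star' g).elim
    | WithInitial.of X, WithInitial.of Y, g, g', h =>
      exact SimplexCategory.Hom.ext (WithInitial.down g) (WithInitial.down g')
        (congrArg TwoCell.toMap h)⟩
  full := ⟨fun {X Y} θ => by
    match X, Y, θ with
    | WithInitial.star, _, _ => exact ⟨default, twoCell_ext fun x => Fin.elim0 x⟩
    | WithInitial.of X, WithInitial.star, θ => exact (TwoCell.toMap θ (0 : Fin (X.len + 1))).elim0
    | WithInitial.of X, WithInitial.of Y, θ =>
      exact ⟨(SimplexCategory.Hom.mk (TwoCell.toMap θ) : X ⟶ Y), rfl⟩⟩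
  essSurj := ⟨fun t => by
    by_cases h : OneCell.size t = 0
    · exact ⟨WithInitial.star, ⟨castIso h.symm⟩⟩
    · exact ⟨WithInitial.of (SimplexCategory.mk (OneCell.size t - 1)),
        nonempty_ofSimplex_iso t (Nat.pos_of_ne_zero h)⟩⟩

theorem whisker_comp_whisker {i j k : AdjObj} {t t' : i ⟶ j} {r r' : j ⟶ k} (η : t ⟶ t')
    (θ : r ⟶ r') : η ▷ r ≫ t' ◁ θ = hcomp η θ := by
  refine (hcomp_comp η (𝟙 t') (𝟙 r) θ).symm.trans ?_
  rw [Category.comp_id, Category.id_comp]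

end AdjObj

/-! ### The theorem -/

theorem mainTheorem2 :
    -- the hom-categories of `adj`
    (AdjObj.fromDeltaAug.IsEquivalence ∧ AdjObj.fromDeltaPM.IsEquivalence ∧
      AdjObj.fromDeltaPlus.IsEquivalence ∧ AdjObj.fromDeltaMinus.IsEquivalence) ∧
    -- identities and composition: concatenation at `1`, reduced concatenation at `0`
    ((𝟙 AdjObj.zero : AdjObj.OneCell _ _).size = 1 ∧
      (𝟙 AdjObj.one : AdjObj.OneCell _ _).size = 0 ∧
      (∀ (i k : AdjObj) (u u' : i ⟶ AdjObj.one) (v v' : AdjObj.one ⟶ k)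
        (η : u ⟶ u') (θ : v ⟶ v'),
        (u ≫ v).size = u.size + v.size ∧
        (∀ (x : Fin u.size) (z : Fin (u ≫ v).size), z.val = x.val →
          ((η ▷ v ≫ u' ◁ θ).toMap z).val = (η.toMap x).val) ∧
        (∀ (y : Fin v.size) (z : Fin (u ≫ v).size), z.val = u.size + y.val →
          ((η ▷ v ≫ u' ◁ θ).toMap z).val = u'.size + (θ.toMap y).val)) ∧
      (∀ (i k : AdjObj) (u u' : i ⟶ AdjObj.zero) (v v' : AdjObj.zero ⟶ k)
        (η : u ⟶ u') (θ : v ⟶ v'),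
        (u ≫ v).size + 1 = u.size + v.size ∧
        (∀ (x : Fin u.size) (z : Fin (u ≫ v).size), z.val = x.val →
          ((η ▷ v ≫ u' ◁ θ).toMap z).val = (η.toMap x).val) ∧
        (∀ (y : Fin v.size) (z : Fin (u ≫ v).size), z.val + 1 = u.size + y.val →
          ((η ▷ v ≫ u' ◁ θ).toMap z).val + 1 = u'.size + (θ.toMap y).val))) ∧
    -- the universal quadruple is an adjoint pair
    AdjObj.univ.IsAdjointPair ∧
    -- the universal property
    ∀ (C : Type u) [Bicategory.{w, v} C] (c c' : C) (P : AdjQuadruple c c'), P.IsAdjointPair →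
      (∃ (F : AdjObj ⥤ᵖ C) (hF : F.obj = AdjObj.objMap c c'),
        Nonempty (AdjQuadruple.Iso ((PseudofunctorOn.of F hF).image AdjObj.univ) P)) ∧
      ∀ (F G : AdjObj ⥤ᵖ C) (hF : F.obj = AdjObj.objMap c c') (hG : G.obj = AdjObj.objMap c c')
        (φ : AdjQuadruple.Iso ((PseudofunctorOn.of F hF).image AdjObj.univ) P)
        (ψ : AdjQuadruple.Iso ((PseudofunctorOn.of G hG).image AdjObj.univ) P),
        ∃! θ : PseudofunctorOn.Iso (PseudofunctorOn.of F hF) (PseudofunctorOn.of G hG),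
          (θ.app AdjObj.univ.f).hom ≫ ψ.isoF.hom = φ.isoF.hom ∧
          (θ.app AdjObj.univ.fv).hom ≫ ψ.isoFv.hom = φ.isoFv.hom := by
  refine ⟨⟨AdjObj.fromDeltaAug_isEquivalence, AdjObj.fromDeltaPM_isEquivalence,
    AdjObj.fromDeltaPlus_isEquivalence, AdjObj.fromDeltaMinus_isEquivalence⟩,
    ⟨rfl, rfl, ?_, ?_⟩, ⟨AdjObj.univAdj, rfl, rfl⟩, ?_⟩
  · intro i k t t' r r' η θ
    rw [AdjObj.whisker_comp_whisker]
    exact ⟨rfl, fun x z h => AdjObj.hcomp_left η θ z x h,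
      fun y z h => AdjObj.hcomp_right η θ z y h⟩
  · intro i k t t' r r' η θ
    rw [AdjObj.whisker_comp_whisker]
    have h1 : 0 < t.size := t.pos_right rfl
    have h2 : 0 < t'.size := t'.pos_right rfl
    refine ⟨Nat.sub_add_cancel (h1.trans_le (Nat.le_add_right _ _)),
      fun x z h => AdjObj.hcomp_left η θ z x h, fun y z h => ?_⟩
    -- The glued element is counted once; since `t` and `t'` are nonempty, the subtractions of one
    -- are exact.
    have h3 := AdjObj.hcomp_right η θ z y (show z.val = t.size - 1 + y.val by omega)
    rw [h3]
    simp only [AdjObj.overlap]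
    omega
  · rintro C _ c c' ⟨f, fv, a, av⟩ ⟨A, h1, h2⟩
    change Bicategory.Adjunction fv f at A
    change A.unit = av at h1
    change A.counit = a at h2
    -- The quadruple now consists of the unit and counit of `A`, the form required by `imageIso` and
    -- `existsUnique`.
    subst h1 h2
    refine ⟨?_, fun F G hF hG φ ψ =>
      AdjObj.Uniqueness.existsUnique (o := AdjObj.objMap c c') (A := A)
        (S := PseudofunctorOn.of F hF) (T := PseudofunctorOn.of G hG) φ ψ⟩
    obtain ⟨E⟩ := AdjObj.Extension.nonempty (o := AdjObj.objMap c c') A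
    exact ⟨E.toPseudofunctorOn.toPseudofunctor, rfl, ⟨E.imageIso⟩⟩
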